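/- A pseudovariety of semigroups is a class of finite semigroups closed under subsemigroups, homomorphic images and finite direct products. Let $\mathsf{DA}$ be the pseudovariety of all finite semigroups in which every regular element (an element $x$ with $x=xyx$ for some $y$) is idempotent. For a finite set $A$, let $\overline{\Omega}_A\mathsf S$ be the free profinite semigroup on $A$, for a pseudovariety $\mathsf V$ let $\overline{\Omega}_A\mathsf V$ be the free pro-$\mathsf V$ semigroup on $A$, and let $p_{\mathsf V}:\overline{\Omega}_A\mathsf S\to\overline{\Omega}_A\mathsf V$ be the canonical projection. Let $\Omega^{\omega}_A\mathsf S$ be the smallest subset of $\overline{\Omega}_A\mathsf S$ that contains the free generators $A$ and is closed under multiplication and under the $\omega$-power $x\mapsto x^{\omega}$ (where $x^\omega$ is the unique idempotent in the closed subsemigroup generated by $x$). A subset $P$ of a finite semigroup $S$ is called $\mathsf V$-pointlike (respectively $\mathsf V$-idempotent pointlike) if, for every finite set $A$ and every continuous homomorphism $\varphi$ from $\overline{\Omega}_A\mathsf S$ onto $S$, there is a subset $P'\subseteq\overline{\Omega}_A\mathsf S$ such that $\varphi(P')=P$ and $p_{\mathsf V}(P')$ is a singleton (respectively, a singleton consisting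 of an idempotent). Theorem. The pseudovariety $\mathsf{DA}$ is $\omega$-reducible for both the pointlike and the idempotent pointlike problems. That is, for every finite semigroup $S$, every finite set $A$ and every continuous homomorphism $\varphi$ from $\overline{\Omega}_A\mathsf S$ onto $S$: (1) for every $\mathsf{DA}$-pointlike subset $P$ of $S$ there is a subset $P'\subseteq\Omega^{\omega}_A\mathsf S$ such that $\varphi(P')=P$ and $p_{\mathsf{DA}}(P')$ is a singleton; (2) for every $\mathsf{DA}$-idempotent pointlike subset $P$ of $S$ there is a subset $P'\subseteq\Omega^{\omega}_A\mathsf S$ such that $\varphi(P')=P$ and $p_{\mathsf{DA}}(P')$ is a singleton consisting of an idempotent. -/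

import Mathlib

open Topology

universe u v w

namespace PV

/-! ### Pseudovarieties of finite semigroups -/

/-- A pseudovariety of semigroups: a class of finite semigroups closed under subsemigroups,
homomorphic images and finite direct products (the trivial semigroup is the empty product;
closure under isomorphism is a special case of closure under homomorphic images). -/
structure Pseudovariety where
  Mem : (S : Type v) → [Semigroup S] → Prop
  finite : ∀ (S : Type v) [Semigroup S], Mem S → Finite S
  trivial_mem : Mem PUnit.{v + 1}
  prod_mem : ∀ (S T : Type v) [Semigroup S] [Semigroup T], Mem S → Mem T → Mem (S × T)
  sub_mem : ∀ (S T : Type v) [Semigroup S] [Semigroup T] (f : S →ₙ* T),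
    Function.Injective f → Mem T → Mem S
  image_mem : ∀ (S T : Type v) [Semigroup S] [Semigroup T] (f : S →ₙ* T),
    Function.Surjective f → Mem S → Mem T

/-- The pseudovariety of all finite semigroups. -/
def allFinite : Pseudovariety.{v} where
  Mem S _ := Finite S
  finite _ _ h := h
  trivial_mem := inferInstance
  prod_mem _ _ _ _ hS hT := by
    have := hS; have := hT; infer_instance
  sub_mem _ _ _ _ f hf hT := by
    have := hT; exact Finite.of_injective f hf
  image_mem _ _ _ _ f hf hS := by
    have := hS; exact Finite.of_surjective f hf

/-! ### The idempotent power in a finite semigroup -/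

section OmegaPower

variable {S : Type u} [Semigroup S] {T : Type v} [Semigroup T]

/-- `spow s n` is the power of `s` with exponent `n + 1`. -/
def spow (s : S) : ℕ → S
  | 0 => s
  | n + 1 => spow s n * s

theorem spow_mul_spow (s : S) (a b : ℕ) : spow s a * spow s b = spow s (a + b + 1) := by
  induction b with
  | zero => rfl
  | succ b ih =>
    change spow s a * (spow s b * s) = spow s (a + b + 1) * s
    rw [← mul_assoc, ih]

theorem spow_spow (s : S) (a b : ℕ) : spow (spow s a) b = spow s (a * b + a + b) := by
  induction b with
  | zero => simp [spow]
  | succ b ih =>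
    change spow (spow s a) b * spow s a = _
    rw [ih, spow_mul_spow]
    congr 1
    ring

theorem map_spow (f : S →ₙ* T) (s : S) (n : ℕ) : f (spow s n) = spow (f s) n := by
  induction n with
  | zero => rfl
  | succ n ih => change f (spow s n * s) = spow (f s) n * f s; rw [map_mul, ih]

theorem spow_of_idem {s : S} (h : s * s = s) (n : ℕ) : spow s n = s := by
  induction n with
  | zero => rfl
  | succ n ih => change spow s n * s = s; rw [ih, h]

theorem exists_idem_spow [Finite S] (s : S) : ∃ n, spow s n * spow s n = spow s n := by
  obtain ⟨i, j, hij, h⟩ : ∃ i j, i < j ∧ spow s i = spow s j := by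
    obtain ⟨i, j, hne, h⟩ := Finite.exists_ne_map_eq_of_infinite (spow s)
    rcases lt_or_gt_of_ne hne with hlt | hlt
    · exact ⟨i, j, hlt, h⟩
    · exact ⟨j, i, hlt, h.symm⟩
  obtain ⟨p, rfl⟩ := Nat.exists_eq_add_of_lt hij
  have step : ∀ k, spow s (i + k) = spow s (i + k + (p + 1)) := by
    intro k
    induction k with
    | zero => simpa [add_assoc] using h
    | succ k ih =>
      have := congrArg (· * s) ih
      change spow s (i + k + 1) = spow s (i + k + (p + 1) + 1) at this
      rw [show i + (k + 1) = i + k + 1 by ring,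
        show i + k + 1 + (p + 1) = i + k + (p + 1) + 1 by ring]
      exact this
  have steps : ∀ m k, spow s (i + k) = spow s (i + k + m * (p + 1)) := by
    intro m k
    induction m with
    | zero => simp
    | succ m ih =>
      rw [ih, add_assoc i k, step]
      congr 1
      ring
  refine ⟨i + (i * p + p), ?_⟩
  rw [spow_mul_spow, steps (i + 1) (i * p + p)]
  congr 1
  ring

theorem idem_spow_unique (s : S) {a b : ℕ} (ha : spow s a * spow s a = spow s a)
    (hb : spow s b * spow s b = spow s b) : spow s a = spow s b := by
  rw [← spow_of_idem ha b, ← spow_of_idem hb a, spow_spow, spow_spow]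
  congr 1
  ring

/-- The `ω`-power of an element of a finite semigroup: its unique idempotent power. -/
noncomputable def omegaPow [Finite S] (s : S) : S := spow s (exists_idem_spow s).choose

theorem omegaPow_idem [Finite S] (s : S) : omegaPow s * omegaPow s = omegaPow s :=
  (exists_idem_spow s).choose_spec

theorem map_omegaPow [Finite S] [Finite T] (f : S →ₙ* T) (s : S) :
    f (omegaPow s) = omegaPow (f s) := by
  have h := congrArg f (omegaPow_idem s)
  rw [map_mul] at h
  unfold omegaPow at h ⊢
  rw [map_spow] at h ⊢
  exact idem_spow_unique (f s) h (omegaPow_idem (f s))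

end OmegaPower

/-! ### The pseudovariety `DA` -/

/-- An element `x` is regular if `x = x y x` for some `y`. -/
def IsRegularElem {S : Type u} [Semigroup S] (x : S) : Prop := ∃ y : S, x * y * x = x

/-- The pseudovariety of all finite semigroups in which all regular elements are idempotents. -/
def DA : Pseudovariety.{v} where
  Mem S _ := Finite S ∧ ∀ x : S, IsRegularElem x → IsIdempotentElem x
  finite _ _ h := h.1
  trivial_mem := ⟨inferInstance, fun _ _ => rfl⟩
  prod_mem S T _ _ hS hT := by
    have := hS.1; have := hT.1
    refine ⟨inferInstance, ?_⟩
    rintro ⟨x₁, x₂⟩ ⟨⟨y₁, y₂⟩, h⟩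
    exact Prod.ext (hS.2 x₁ ⟨y₁, congrArg Prod.fst h⟩) (hT.2 x₂ ⟨y₂, congrArg Prod.snd h⟩)
  sub_mem S T _ _ f hf hT := by
    have := hT.1
    refine ⟨Finite.of_injective f hf, ?_⟩
    rintro x ⟨y, h⟩
    apply hf
    rw [map_mul]
    exact hT.2 (f x) ⟨f y, by rw [← map_mul, ← map_mul, h]⟩
  image_mem S T _ _ f hf hS := by
    have := hS.1
    have := Finite.of_surjective f hf
    refine ⟨inferInstance, ?_⟩
    rintro t ⟨z, h⟩
    obtain ⟨s, rfl⟩ := hf t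
    obtain ⟨y, rfl⟩ := hf z
    -- the element `(s y)^ω s` is regular and is mapped to the same element as `s`
    obtain ⟨n, hn⟩ := exists_idem_spow (s * y)
    have hfix : ∀ k, spow (f s * f y) k * f s = f s := by
      intro k
      induction k with
      | zero => exact h
      | succ k ih =>
        change spow (f s * f y) k * (f s * f y) * f s = f s
        rw [mul_assoc, h, ih]
    have hreg : IsRegularElem (spow (s * y) n * s) := by
      refine ⟨y * spow (s * y) (n + n), ?_⟩
      have e : spow (s * y) n * s * (y * spow (s * y) (n + n)) * (spow (s * y) n * s)
          = (spow (s * y) n * (s * y)) * spow (s * y) (n + n) * spow (s * y) n * s := by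
        simp only [mul_assoc]
      rw [e]
      change spow (s * y) (n + 1) * spow (s * y) (n + n) * spow (s * y) n * s = _
      have e2 : spow (s * y) (n + 1) * spow (s * y) (n + n)
          = spow (s * y) n * spow (s * y) n * spow (s * y) n := by
        rw [spow_mul_spow, spow_mul_spow, spow_mul_spow]
        congr 1
        ring
      rw [e2, hn, hn, hn]
    have hi := congrArg f (hS.2 _ hreg)
    have hm : f (spow (s * y) n * s) = f s := by
      rw [map_mul, map_spow, map_mul, hfix]
    rw [map_mul, hm] at hi
    exact hi

/-! ### Relatively free profinite semigroups -/

/-- The homomorphism induced on a quotient by a homomorphism compatible with the congruence. -/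
def quotLift {M : Type u} {T : Type v} [Mul M] [Mul T] (c : Con M) (f : M →ₙ* T)
    (h : c ≤ Con.ker f) : c.Quotient →ₙ* T where
  toFun q := Con.liftOn q f (fun _ _ hab => h hab)
  map_mul' p q := by
    induction p using Con.induction_on
    induction q using Con.induction_on
    rw [← Con.coe_mul]
    exact map_mul f _ _

/-- The natural homomorphism `M/c → M/d` for congruences `c ≤ d`. -/
def quotMap {M : Type u} [Mul M] {c d : Con M} (h : c ≤ d) : c.Quotient →ₙ* d.Quotient :=
  quotLift c d.mkMulHom (by rw [Con.ker_mkMulHom_eq]; exact h)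

/-- The congruences on the free semigroup on `A` whose quotient lies in `V`. -/
abbrev VCon (V : Pseudovariety.{v}) (A : Type v) : Type v :=
  {c : Con (FreeSemigroup A) // V.Mem c.Quotient}

/-- The free pro-`V` semigroup on `A`, for a finite set `A`:
the projective limit of all `A`-generated members of `V`. -/
def FreePro (V : Pseudovariety.{v}) (A : Type v) : Type v :=
  {x : (c : VCon V A) → c.1.Quotient //
    ∀ (c d : VCon V A) (h : c.1 ≤ d.1), quotMap h (x c) = x d}

namespace FreePro

variable {V : Pseudovariety.{v}} {A : Type v}

theorem ext {x y : FreePro V A} (h : ∀ c, x.1 c = y.1 c) : x = y :=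
  Subtype.ext (funext h)

instance : Semigroup (FreePro V A) where
  mul x y := ⟨fun c => x.1 c * y.1 c, fun c d h => by rw [map_mul, x.2 c d h, y.2 c d h]⟩
  mul_assoc x y z := ext fun c => mul_assoc (x.1 c) (y.1 c) (z.1 c)

/-- The topology of the projective limit of discrete spaces. -/
instance : TopologicalSpace (FreePro V A) :=
  ⨅ c : VCon V A, TopologicalSpace.induced (fun x => x.1 c) ⊥

/-- The free generators. -/
def of (V : Pseudovariety.{v}) {A : Type v} (a : A) : FreePro V A :=
  ⟨fun c => (FreeSemigroup.of a : c.1.Quotient), fun _ _ _ => rfl⟩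

end FreePro

/-- The free profinite semigroup on `A`; its elements are the pseudowords on `A`. -/
abbrev FreeProfinite (A : Type v) : Type v := FreePro allFinite A

/-- The canonical projection of the free profinite semigroup onto the free pro-`V` semigroup. -/
def proj (V : Pseudovariety.{v}) (A : Type v) : FreeProfinite A →ₙ* FreePro V A where
  toFun x := ⟨fun c => x.1 ⟨c.1, V.finite _ c.2⟩, fun c d h =>
    x.2 ⟨c.1, V.finite _ c.2⟩ ⟨d.1, V.finite _ d.2⟩ h⟩
  map_mul' _ _ := rfl

/-! ### Pseudowords as implicit operations -/

theorem finite_quotient_ker {M : Type u} {T : Type v} [Mul M] [Mul T] [Finite T] (f : M →ₙ* T) :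
    Finite (Con.ker f).Quotient := by
  refine Finite.of_injective (quotLift (Con.ker f) f le_rfl) ?_
  intro p q
  induction p using Con.induction_on
  induction q using Con.induction_on
  intro h
  exact (Con.eq _).2 h

/-- The kernel of the homomorphism from the free semigroup on `B` extending `t`. -/
def evalCon {B : Type u} {T : Type v} [Semigroup T] [Finite T] (t : B → T) :
    VCon allFinite B :=
  ⟨Con.ker (FreeSemigroup.lift t), finite_quotient_ker _⟩

/-- The value in a finite semigroup `T` of a pseudoword when the letters are evaluated by `t`:
the image of the pseudoword under the unique continuous homomorphism extending `t`. -/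
def eval {B : Type u} {T : Type v} [Semigroup T] [Finite T] (x : FreeProfinite B) (t : B → T) :
    T :=
  quotLift (evalCon t).1 (FreeSemigroup.lift t) le_rfl (x.1 (evalCon t))

theorem map_eval {B : Type u} {T : Type v} {T' : Type w} [Semigroup T] [Finite T] [Semigroup T']
    [Finite T'] (x : FreeProfinite B) (t : B → T) (f : T →ₙ* T') :
    f (eval x t) = eval x (f ∘ t) := by
  have hlift : ∀ a, f (FreeSemigroup.lift t a) = FreeSemigroup.lift (f ∘ t) a := by
    intro a
    have : f.comp (FreeSemigroup.lift t) = FreeSemigroup.lift (f ∘ t) :=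
      FreeSemigroup.hom_ext (funext fun b => by simp)
    exact DFunLike.congr_fun this a
  have hle : (evalCon t).1 ≤ (evalCon (f ∘ t)).1 := by
    intro a b (hab : FreeSemigroup.lift t a = FreeSemigroup.lift t b)
    change FreeSemigroup.lift (f ∘ t) a = FreeSemigroup.lift (f ∘ t) b
    rw [← hlift, ← hlift, hab]
  unfold eval
  rw [← x.2 (evalCon t) (evalCon (f ∘ t)) hle]
  generalize x.1 (evalCon t) = q
  induction q using Con.induction_on
  exact hlift _

/-- The natural interpretation of a pseudoword as an operation on a free profinite semigroup. -/
def interp {B : Type u} {A : Type v} (x : FreeProfinite B) (t : B → FreeProfinite A) :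
    FreeProfinite A :=
  ⟨fun c => haveI : Finite c.1.Quotient := c.2; eval x (fun b => (t b).1 c), fun c d h => by
    have : Finite c.1.Quotient := c.2
    have : Finite d.1.Quotient := d.2
    change quotMap h (eval x (fun b => (t b).1 c)) = eval x (fun b => (t b).1 d)
    rw [map_eval]
    congr 1
    funext b
    exact (t b).2 c d h⟩

/-! ### Implicit signatures -/

/-- The binary multiplication, as a pseudoword on two letters. -/
def mulWord : FreeProfinite (Fin 2) := FreePro.of allFinite 0 * FreePro.of allFinite 1

/-- The unary `ω`-power, as a pseudoword on one letter. -/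
noncomputable def omegaWord : FreeProfinite (Fin 1) :=
  ⟨fun c => haveI : Finite c.1.Quotient := c.2
    omegaPow ((FreePro.of allFinite (0 : Fin 1)).1 c), fun c d h => by
    have : Finite c.1.Quotient := c.2
    have : Finite d.1.Quotient := d.2
    exact (map_omegaPow (quotMap h) _).trans
      (congrArg omegaPow ((FreePro.of allFinite (0 : Fin 1)).2 c d h))⟩

/-- An implicit signature: a set of pseudowords, each with its finite arity,
containing the binary multiplication. -/
structure ImplicitSignature where
  ops : (n : ℕ) → Set (FreeProfinite (Fin n))
  mul_mem : mulWord ∈ ops 2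

/-- Membership in the `σ`-subalgebra of the free profinite semigroup on `A` generated by `A`. -/
inductive IsTerm (σ : ImplicitSignature) (A : Type v) : FreeProfinite A → Prop
  | of (a : A) : IsTerm σ A (FreePro.of allFinite a)
  | app {n : ℕ} (x : FreeProfinite (Fin n)) (hx : x ∈ σ.ops n) (t : Fin n → FreeProfinite A)
      (ht : ∀ i, IsTerm σ A (t i)) : IsTerm σ A (interp x t)

/-- The signature `ω`, consisting of the multiplication and the `ω`-power. -/
def omegaSignature : ImplicitSignature where
  ops n := {x | (⟨n, x⟩ : Σ m, FreeProfinite (Fin m)) = ⟨2, mulWord⟩ ∨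
    (⟨n, x⟩ : Σ m, FreeProfinite (Fin m)) = ⟨1, omegaWord⟩}
  mul_mem := Or.inl rfl

/-! ### Pointlike sets and reducibility -/

section Pointlike

variable {S : Type u} [Semigroup S]

/-- `φ` is a continuous homomorphism onto the semigroup `S` with its discrete topology. -/
def IsContinuousOnto {A : Type v} (φ : FreeProfinite A →ₙ* S) : Prop :=
  Continuous[inferInstance, ⊥] φ ∧ Function.Surjective φ

/-- `P'` is sent onto `P` by `φ` and onto a singleton by the projection to the free
pro-`V` semigroup. -/
def IsWitness (V : Pseudovariety.{v}) {A : Type v} (φ : FreeProfinite A →ₙ* S) (P : Set S)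
    (P' : Set (FreeProfinite A)) : Prop :=
  φ '' P' = P ∧ ∃ e : FreePro V A, proj V A '' P' = {e}

/-- `P'` is sent onto `P` by `φ` and onto a singleton consisting of an idempotent by the
projection to the free pro-`V` semigroup. -/
def IsIdempotentWitness (V : Pseudovariety.{v}) {A : Type v} (φ : FreeProfinite A →ₙ* S)
    (P : Set S) (P' : Set (FreeProfinite A)) : Prop :=
  φ '' P' = P ∧ ∃ e : FreePro V A, IsIdempotentElem e ∧ proj V A '' P' = {e}

/-- `P` is a `V`-pointlike subset of the finite semigroup `S`. -/
def IsPointlike (V : Pseudovariety.{v}) (P : Set S) : Prop :=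
  ∀ (A : Type v) [Finite A] (φ : FreeProfinite A →ₙ* S), IsContinuousOnto φ →
    ∃ P' : Set (FreeProfinite A), IsWitness V φ P P'

/-- `P` is a `V`-idempotent pointlike subset of the finite semigroup `S`. -/
def IsIdempotentPointlike (V : Pseudovariety.{v}) (P : Set S) : Prop :=
  ∀ (A : Type v) [Finite A] (φ : FreeProfinite A →ₙ* S), IsContinuousOnto φ →
    ∃ P' : Set (FreeProfinite A), IsIdempotentWitness V φ P P'

end Pointlike

/-- The `V`-pointlike problem is `σ`-reducible: for finite semigroups in the universe `u`, the
sets witnessing that a subset is `V`-pointlike can always be chosen to consist of `σ`-terms. -/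
def PointlikeReducible (σ : ImplicitSignature) (V : Pseudovariety.{v}) : Prop :=
  ∀ (S : Type u) [Semigroup S] [Finite S] (P : Set S), IsPointlike V P →
    ∀ (A : Type v) [Finite A] (φ : FreeProfinite A →ₙ* S), IsContinuousOnto φ →
      ∃ P' : Set (FreeProfinite A), (∀ x ∈ P', IsTerm σ A x) ∧ IsWitness V φ P P'

/-- The `V`-idempotent pointlike problem is `σ`-reducible. -/
def IdempotentPointlikeReducible (σ : ImplicitSignature) (V : Pseudovariety.{v}) : Prop :=
  ∀ (S : Type u) [Semigroup S] [Finite S] (P : Set S), IsIdempotentPointlike V P →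
    ∀ (A : Type v) [Finite A] (φ : FreeProfinite A →ₙ* S), IsContinuousOnto φ →
      ∃ P' : Set (FreeProfinite A), (∀ x ∈ P', IsTerm σ A x) ∧ IsIdempotentWitness V φ P P'

end PV

namespace PV

/-! ### Absorption in semigroups all of whose regular elements are idempotents -/

section Absorption

variable {M : Type*} [Monoid M]

/-! Words suffice on the `S` side: as `φ` is continuous, every pseudoword `x` has the same image as
some word agreeing with `x` in any prescribed finite quotient. So it is enough to find one
congruence `c` of finite index on words, with quotient in `DA`, such that for each `c`-class the
images in `S` (with an identity adjoined) are images of `ω`-terms sharing one value over `DA`,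
idempotent whenever the class is. The class met by the common projection of a witness then contains
words representing all of `P`, and the corresponding terms replace the witness. This congruence is
built in `IsTermRelation.exists_con`, by induction on the number of letters.

For a class of words with letter set `B`, shortest prefixes and suffixes containing all of `B` are
peeled off. Such a block is a word over fewer letters together with one new letter, so the induction
hypothesis applies to it. One refinement by `splitCon` makes one peeling valid simultaneously for
all congruent words, and `IsDACon.splitCon` keeps the quotient in `DA`. If the full blocks soon run
out, the class lies in a short product of sets already handled. Otherwise there are many blocks on
each side, and the pigeonhole principle in the power monoid yields on each side an idempotent set,
whose elements have a common `ω`-power as value (`omega_of_idempotent_set`).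

What lies between the two idempotents is irrelevant: in `DA`, `f * z * g = f * g` when `f`, `g` are
idempotents with the same letters and `z` uses only these (`sandwich_word_pair`). This also makes
the resulting value idempotent. An idempotent class contains large powers of its words, so it always
falls in this second case. -/

theorem sandwich_of_dvd (hM : ∀ x : M, IsRegularElem x → IsIdempotentElem x) {e a x y : M}
    (he : IsIdempotentElem e) (h : e = x * a * y) : e * a * e = e := by
  -- If `e` and `e * p` are right equivalent, then `e * p` is regular, hence idempotent, and
  -- cancelling with `q` gives the claim. The two-sided case follows by absorbing `a * y` on the
  -- left and then `a` on the right.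
  have right : ∀ p q : M, e = e * p * q → e * p * e = e := by
    intro p q hpq
    have hi : IsIdempotentElem (e * p) := hM _ ⟨q * e, by
      calc e * p * (q * e) * (e * p) = (e * p * q) * (e * e) * p := by simp only [mul_assoc]
        _ = e * p := by rw [← hpq, he.eq, he.eq]⟩
    calc e * p * e = e * p * (e * p * q) := by rw [← hpq]
      _ = (e * p) * (e * p) * q := by simp only [mul_assoc]
      _ = e := by rw [hi.eq, ← hpq]
  have left : ∀ p q : M, e = p * q * e → e * q * e = e := by
    intro p q hpq
    have hi : IsIdempotentElem (q * e) := hM _ ⟨e * p, by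
      calc q * e * (e * p) * (q * e) = q * (e * e) * (p * q * e) := by simp only [mul_assoc]
        _ = q * e := by rw [← hpq, he.eq, mul_assoc, he.eq]⟩
    calc e * q * e = p * q * e * q * e := by rw [← hpq]
      _ = p * ((q * e) * (q * e)) := by simp only [mul_assoc]
      _ = e := by rw [hi.eq, ← mul_assoc, ← hpq]
  have h1 : e * (a * y) * e = e := left x (a * y) (by
    calc e = e * e := he.eq.symm
      _ = x * a * y * e := by rw [← h]
      _ = x * (a * y) * e := by simp only [mul_assoc])
  exact right a (y * e) (by rw [← mul_assoc, mul_assoc e a y, h1])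

/-- The element `t * e * s` is regular with `e` as a witness, hence idempotent. Replacing the outer
copies of `e` by `e * t * e` and `e * s * e` exposes its square. -/
theorem sandwich_mul (hM : ∀ x : M, IsRegularElem x → IsIdempotentElem x) {e s t : M}
    (hs : e * s * e = e) (ht : e * t * e = e) :
    e * (s * t) * e = e := by
  have hi : IsIdempotentElem (t * e * s) := hM _ ⟨e, by
    calc t * e * s * e * (t * e * s) = t * (e * s * e) * t * e * s := by simp only [mul_assoc]
      _ = t * (e * t * e) * s := by rw [hs]; simp only [mul_assoc]
      _ = t * e * s := by rw [ht]⟩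
  calc e * (s * t) * e = (e * t * e) * (s * t) * (e * s * e) := by rw [hs, ht]
    _ = e * ((t * e * s) * (t * e * s)) * e := by simp only [mul_assoc]
    _ = (e * t * e) * s * e := by rw [hi.eq]; simp only [mul_assoc]
    _ = e := by rw [ht, hs]

variable {A : Type*}

theorem exists_eq_mul_of_mem {a : A} {w : FreeMonoid A} (h : a ∈ w) :
    ∃ x y, w = x * FreeMonoid.of a * y := by
  obtain ⟨x, y, h⟩ := List.append_of_mem (show a ∈ FreeMonoid.toList w from h)
  refine ⟨FreeMonoid.ofList x, FreeMonoid.ofList y, ?_⟩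
  rw [mul_assoc]
  exact h

variable [DecidableEq A]

/-- Each letter of `w` occurs in `u`, so its value divides the idempotent `μ u` and is absorbed;
`sandwich_mul` then passes from letters to words. -/
theorem sandwich_word (hM : ∀ x : M, IsRegularElem x → IsIdempotentElem x)
    (μ : FreeMonoid A →* M) {u w : FreeMonoid A} (he : IsIdempotentElem (μ u))
    (h : w.symbols ⊆ u.symbols) : μ u * μ w * μ u = μ u := by
  induction w using FreeMonoid.inductionOn' with
  | one => rw [map_one, mul_one, he.eq]
  | of_mul a w ih =>
    rw [FreeMonoid.symbols_mul, Finset.union_subset_iff] at h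
    rw [map_mul]
    refine sandwich_mul hM ?_ (ih h.2)
    have ha : a ∈ u.symbols := h.1 (by simp)
    obtain ⟨x, y, hxy⟩ := exists_eq_mul_of_mem (FreeMonoid.mem_symbols.1 ha)
    exact sandwich_of_dvd hM he (x := μ x) (y := μ y) (by rw [← map_mul, ← map_mul, ← hxy])

/-- Writing `μ v` as `μ v * μ u * μ v` puts `w * v` between two copies of `μ u`, where it is
absorbed. -/
theorem sandwich_word_pair (hM : ∀ x : M, IsRegularElem x → IsIdempotentElem x)
    (μ : FreeMonoid A →* M) {u v w : FreeMonoid A} (hu : IsIdempotentElem (μ u))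
    (hv : IsIdempotentElem (μ v)) (huv : u.symbols = v.symbols) (h : w.symbols ⊆ u.symbols) :
    μ u * μ w * μ v = μ u * μ v := by
  have hvu := sandwich_word hM μ hv huv.subset
  calc μ u * μ w * μ v = μ u * μ w * (μ v * μ u * μ v) := by rw [hvu]
    _ = (μ u * μ (w * v) * μ u) * μ v := by rw [map_mul]; simp only [mul_assoc]
    _ = μ u * μ v := by
      have hwv : (w * v).symbols ⊆ u.symbols := by
        rw [FreeMonoid.symbols_mul, ← huv]
        exact Finset.union_subset h subset_rfl
      rw [sandwich_word hM μ hu hwv]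

end Absorption

/-! ### Congruences on words -/

section Words

variable {A : Type*}

theorem mem_reverse_word {a : A} {w : FreeMonoid A} : a ∈ w.reverse ↔ a ∈ w :=
  List.mem_reverse (as := w.toList)

/-- Congruences of finite index on the free monoid whose quotient has only idempotent regular
elements. -/
structure IsDACon (c : Con (FreeMonoid A)) : Prop where
  finite : Finite c.Quotient
  idem : ∀ x y, c (x * y * x) x → c (x * x) x

theorem IsDACon.quotient {c : Con (FreeMonoid A)} (h : IsDACon c) (x : c.Quotient)
    (hx : IsRegularElem x) : IsIdempotentElem x := by
  obtain ⟨y, hy⟩ := hx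
  induction x using Con.induction_on
  induction y using Con.induction_on
  rw [← Con.coe_mul, ← Con.coe_mul, Con.eq] at hy
  change _ * _ = _
  rw [← Con.coe_mul, Con.eq]
  exact h.idem _ _ hy

theorem isDACon_top : IsDACon (⊤ : Con (FreeMonoid A)) where
  finite := by
    have : Subsingleton (⊤ : Con (FreeMonoid A)).Quotient := ⟨fun x y => by
      induction x using Con.induction_on
      induction y using Con.induction_on
      exact (Con.eq _).2 trivial⟩
    infer_instance
  idem _ _ _ := trivial

/-- The congruence on reversed words. -/
def revCon (c : Con (FreeMonoid A)) : Con (FreeMonoid A) where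
  r u v := c u.reverse v.reverse
  iseqv := ⟨fun _ => c.refl _, fun h => c.symm h, fun h h' => c.trans h h'⟩
  mul' h h' := by
    rw [FreeMonoid.reverse_mul, FreeMonoid.reverse_mul]
    exact c.mul h' h

theorem revCon_apply {c : Con (FreeMonoid A)} {u v : FreeMonoid A} :
    revCon c u v ↔ c u.reverse v.reverse := Iff.rfl

theorem IsDACon.rev {c : Con (FreeMonoid A)} (h : IsDACon c) : IsDACon (revCon c) where
  finite := by
    have := h.finite
    refine Finite.of_injective (β := c.Quotient)
      (fun q => Con.liftOn q (fun w => ((w.reverse : FreeMonoid A) : c.Quotient))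
        (fun u v huv => (Con.eq _).2 huv)) ?_
    intro x y hxy
    induction x using Con.induction_on
    induction y using Con.induction_on
    exact (Con.eq _).2 ((Con.eq c).1 hxy)
  idem x y hxy := by
    rw [revCon_apply, FreeMonoid.reverse_mul] at *
    rw [FreeMonoid.reverse_mul, ← mul_assoc] at hxy
    exact h.idem _ _ hxy

theorem finite_inf_quotient {M : Type*} [Mul M] {c d : Con M} (hc : Finite c.Quotient)
    (hd : Finite d.Quotient) : Finite (c ⊓ d).Quotient := by
  refine Finite.of_injective (β := c.Quotient × d.Quotient)
    (fun q => Con.liftOn q (fun w => ((w : c.Quotient), (w : d.Quotient)))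
      (fun u v huv => Prod.ext ((Con.eq _).2 huv.1) ((Con.eq _).2 huv.2))) ?_
  intro x y hxy
  induction x using Con.induction_on
  induction y using Con.induction_on
  exact (Con.eq _).2 ⟨(Con.eq _).1 (congrArg Prod.fst hxy), (Con.eq _).1 (congrArg Prod.snd hxy)⟩

theorem IsDACon.inf {c d : Con (FreeMonoid A)} (hc : IsDACon c) (hd : IsDACon d) :
    IsDACon (c ⊓ d) where
  finite := finite_inf_quotient hc.finite hd.finite
  idem x y hxy := ⟨hc.idem x y hxy.1, hd.idem x y hxy.2⟩

/-! ### Splitting words at first and last occurrences of letters. -/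

variable [DecidableEq A]

/-- The part of a word before the first occurrence of a letter. -/
def beforeFirst (a : A) : List A → List A
  | [] => []
  | b :: l => if b = a then [] else b :: beforeFirst a l

/-- The part of a word after the first occurrence of a letter, empty if there is none. -/
def afterFirst (a : A) : List A → List A
  | [] => []
  | b :: l => if b = a then l else afterFirst a l

theorem beforeFirst_append (a : A) (u v : List A) :
    beforeFirst a (u ++ v) = if a ∈ u then beforeFirst a u else u ++ beforeFirst a v := by
  induction u with
  | nil => simp
  | cons b u ih =>
    by_cases h : b = a
    · simp [beforeFirst, h]
    · by_cases hu : a ∈ u <;> simp [beforeFirst, h, Ne.symm h, ih, hu]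

theorem afterFirst_append (a : A) (u v : List A) :
    afterFirst a (u ++ v) = if a ∈ u then afterFirst a u ++ v else afterFirst a v := by
  induction u with
  | nil => simp
  | cons b u ih =>
    by_cases h : b = a
    · simp [afterFirst, h]
    · by_cases hu : a ∈ u <;> simp [afterFirst, h, Ne.symm h, ih, hu]

theorem beforeFirst_append_afterFirst {a : A} {u : List A} (h : a ∈ u) :
    beforeFirst a u ++ a :: afterFirst a u = u := by
  induction u with
  | nil => simp at h
  | cons b u ih =>
    by_cases hb : b = a
    · simp [beforeFirst, afterFirst, hb]
    · have : a ∈ u := by simpa [Ne.symm hb] using h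
      simp [beforeFirst, afterFirst, hb, ih this]

/-- The prefix of a word before the first occurrence of a letter. -/
def pre (a : A) (w : FreeMonoid A) : FreeMonoid A := FreeMonoid.ofList (beforeFirst a w.toList)

/-- The suffix of a word after the first occurrence of a letter. -/
def suf (a : A) (w : FreeMonoid A) : FreeMonoid A := FreeMonoid.ofList (afterFirst a w.toList)

theorem pre_mul_of_mem {a : A} {u : FreeMonoid A} (h : a ∈ u) (v : FreeMonoid A) :
    pre a (u * v) = pre a u :=
  (beforeFirst_append a u.toList v.toList).trans (if_pos h)

theorem pre_mul_of_notMem {a : A} {u : FreeMonoid A} (h : a ∉ u) (v : FreeMonoid A) :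
    pre a (u * v) = u * pre a v :=
  (beforeFirst_append a u.toList v.toList).trans (if_neg h)

theorem suf_mul_of_mem {a : A} {u : FreeMonoid A} (h : a ∈ u) (v : FreeMonoid A) :
    suf a (u * v) = suf a u * v :=
  (afterFirst_append a u.toList v.toList).trans (if_pos h)

theorem suf_mul_of_notMem {a : A} {u : FreeMonoid A} (h : a ∉ u) (v : FreeMonoid A) :
    suf a (u * v) = suf a v :=
  (afterFirst_append a u.toList v.toList).trans (if_neg h)

theorem pre_mul_suf {a : A} {u : FreeMonoid A} (h : a ∈ u) :
    pre a u * FreeMonoid.of a * suf a u = u := by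
  rw [mul_assoc]
  exact beforeFirst_append_afterFirst h

theorem pre_of (a : A) (v : FreeMonoid A) : pre a (FreeMonoid.of a * v) = 1 := by
  change beforeFirst a (a :: v.toList) = []
  simp [beforeFirst]

theorem suf_of (a : A) (v : FreeMonoid A) : suf a (FreeMonoid.of a * v) = v := by
  change afterFirst a (a :: v.toList) = v
  simp [afterFirst]
  rfl

theorem pre_factor {a : A} {u : FreeMonoid A} (h : a ∉ u) (v : FreeMonoid A) :
    pre a (u * FreeMonoid.of a * v) = u := by
  rw [mul_assoc, pre_mul_of_notMem h, pre_of, mul_one]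

theorem suf_factor {a : A} {u : FreeMonoid A} (h : a ∉ u) (v : FreeMonoid A) :
    suf a (u * FreeMonoid.of a * v) = v := by
  rw [mul_assoc, suf_mul_of_notMem h, suf_of]

/-- Refinement of a congruence by the factorizations at first occurrences of letters. -/
def firstCon (c : Con (FreeMonoid A)) : Con (FreeMonoid A) where
  r u v := c u v ∧ ∀ a, (a ∈ u ↔ a ∈ v) ∧ c (pre a u) (pre a v) ∧ c (suf a u) (suf a v)
  iseqv := ⟨fun _ => ⟨c.refl _, fun _ => ⟨Iff.rfl, c.refl _, c.refl _⟩⟩,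
    fun h => ⟨c.symm h.1, fun a => ⟨(h.2 a).1.symm, c.symm (h.2 a).2.1, c.symm (h.2 a).2.2⟩⟩,
    fun h h' => ⟨c.trans h.1 h'.1, fun a => ⟨(h.2 a).1.trans (h'.2 a).1,
      c.trans (h.2 a).2.1 (h'.2 a).2.1, c.trans (h.2 a).2.2 (h'.2 a).2.2⟩⟩⟩
  mul' {w x y z} h h' := ⟨c.mul h.1 h'.1, fun a => by
    obtain ⟨h1, h2, h3⟩ := h.2 a
    obtain ⟨h1', h2', h3'⟩ := h'.2 a
    refine ⟨by rw [FreeMonoid.mem_mul, FreeMonoid.mem_mul, h1, h1'], ?_⟩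
    by_cases hw : a ∈ w
    · have hx := h1.1 hw
      rw [pre_mul_of_mem hw, pre_mul_of_mem hx, suf_mul_of_mem hw, suf_mul_of_mem hx]
      exact ⟨h2, c.mul h3 h'.1⟩
    · have hx := fun k => hw (h1.2 k)
      rw [pre_mul_of_notMem hw, pre_mul_of_notMem hx, suf_mul_of_notMem hw, suf_mul_of_notMem hx]
      exact ⟨c.mul h.1 h2', h3'⟩⟩

theorem firstCon_apply {c : Con (FreeMonoid A)} {u v : FreeMonoid A} :
    firstCon c u v ↔
      c u v ∧ ∀ a, (a ∈ u ↔ a ∈ v) ∧ c (pre a u) (pre a v) ∧ c (suf a u) (suf a v) := Iff.rfl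

/-- The point is the suffix. If `x = p * s` with `p` ending at the first `a`, then the suffix of `x
* y * x` is `s * y * p * s`. Its congruence with `s` makes `s` idempotent and divisible by `p`, so
absorption gives `s * p * s ~ s`, which compares the suffixes of `x * x` and `x`. -/
theorem IsDACon.firstCon [Finite A] {c : Con (FreeMonoid A)} (h : IsDACon c) :
    IsDACon (firstCon c) where
  finite := by
    have := h.finite
    refine Finite.of_injective (β := c.Quotient × (A → Prop × c.Quotient × c.Quotient))
      (fun q => Con.liftOn q (fun w => ((w : c.Quotient),
        fun a => (a ∈ w, (pre a w : c.Quotient), (suf a w : c.Quotient))))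
        (fun u v huv => Prod.ext ((Con.eq _).2 huv.1) (funext fun a =>
          Prod.ext (propext (huv.2 a).1) (Prod.ext ((Con.eq _).2 (huv.2 a).2.1)
            ((Con.eq _).2 (huv.2 a).2.2))))) ?_
    intro x y hxy
    induction x using Con.induction_on
    induction y using Con.induction_on
    refine (Con.eq _).2 ⟨(Con.eq _).1 (congrArg Prod.fst hxy), fun a => ?_⟩
    have ha := congrFun (congrArg Prod.snd hxy) a
    exact ⟨iff_of_eq (congrArg Prod.fst ha), (Con.eq _).1 (congrArg (fun p => p.2.1) ha),
      (Con.eq _).1 (congrArg (fun p => p.2.2) ha)⟩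
  idem x y hxy := by
    refine ⟨h.idem x y hxy.1, fun a => ⟨by rw [FreeMonoid.mem_mul, or_self], ?_⟩⟩
    by_cases ha : a ∈ x
    · rw [pre_mul_of_mem ha, suf_mul_of_mem ha]
      refine ⟨c.refl _, ?_⟩
      have h3 := (hxy.2 a).2.2
      rw [mul_assoc, suf_mul_of_mem ha] at h3
      have hx := pre_mul_suf ha
      set s := suf a x
      set p := pre a x * FreeMonoid.of a with hp
      rw [← hx] at h3 ⊢
      have hs : c (s * s) s := h.idem s (y * p) (by simpa only [mul_assoc] using h3)
      rw [← Con.eq] at h3 hs ⊢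
      simp only [Con.coe_mul] at h3 hs ⊢
      have := sandwich_of_dvd h.quotient (e := (s : c.Quotient)) (a := (p : c.Quotient))
        (x := (s : c.Quotient) * (y : c.Quotient)) (y := (s : c.Quotient)) hs
        (by rw [← h3]; simp only [mul_assoc, h3])
      simpa only [mul_assoc] using this
    · rw [pre_mul_of_notMem ha, suf_mul_of_notMem ha]
      refine ⟨?_, c.refl _⟩
      have h2 := (hxy.2 a).2.1
      rw [mul_assoc, pre_mul_of_notMem ha] at h2
      -- For a letter that does not occur, `pre` returns the whole word, and the claim becomes that
      -- `x` is idempotent modulo `c`.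
      have h1 : pre a x = x := by
        have := pre_mul_of_notMem ha 1
        rwa [mul_one, show pre a (1 : FreeMonoid A) = 1 from rfl, mul_one] at this
      rw [h1]
      exact h.idem x y hxy.1

/-- Refinement of a congruence by the factorizations at first and last occurrences of letters. -/
def splitCon (c : Con (FreeMonoid A)) : Con (FreeMonoid A) :=
  firstCon c ⊓ revCon (firstCon (revCon c))

theorem IsDACon.splitCon [Finite A] {c : Con (FreeMonoid A)} (h : IsDACon c) :
    IsDACon (splitCon c) := h.firstCon.inf h.rev.firstCon.rev

theorem splitCon_le (c : Con (FreeMonoid A)) : splitCon c ≤ c := fun _ _ h => h.1.1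

theorem splitCon_symbols {c : Con (FreeMonoid A)} {u v : FreeMonoid A} (h : splitCon c u v) :
    u.symbols = v.symbols := by
  ext a
  simpa using (h.1.2 a).1

/-- A factorization at a first occurrence transfers to every congruent word, at the cost of one
layer of `splitCon`; `splitCon_right` does this for last occurrences. -/
theorem splitCon_left {c : Con (FreeMonoid A)} {a : A} {u₀ u₁ v : FreeMonoid A} (hu : a ∉ u₀)
    (h : splitCon c (u₀ * FreeMonoid.of a * u₁) v) :
    ∃ v₀ v₁, v = v₀ * FreeMonoid.of a * v₁ ∧ c u₀ v₀ ∧ c u₁ v₁ := by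
  obtain ⟨h1, h2, h3⟩ := h.1.2 a
  rw [pre_factor hu] at h2
  rw [suf_factor hu] at h3
  exact ⟨_, _, (pre_mul_suf (h1.1 (by simp [FreeMonoid.mem_mul]))).symm, h2, h3⟩

theorem splitCon_right {c : Con (FreeMonoid A)} {a : A} {u₀ u₁ v : FreeMonoid A} (hu : a ∉ u₁)
    (h : splitCon c (u₀ * FreeMonoid.of a * u₁) v) :
    ∃ v₀ v₁, v = v₀ * FreeMonoid.of a * v₁ ∧ c u₀ v₀ ∧ c u₁ v₁ := by
  obtain ⟨h1, h2, h3⟩ := (firstCon_apply.1 (revCon_apply.1 h.2)).2 a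
  rw [FreeMonoid.reverse_mul, FreeMonoid.reverse_mul, FreeMonoid.reverse_of, ← mul_assoc] at h1 h2 h3
  have hu' : a ∉ u₁.reverse := fun k => hu (mem_reverse_word.1 k)
  rw [pre_factor hu', revCon_apply, FreeMonoid.reverse_reverse] at h2
  rw [suf_factor hu', revCon_apply, FreeMonoid.reverse_reverse] at h3
  refine ⟨_, _, ?_, h3, h2⟩
  have := congrArg FreeMonoid.reverse
    (pre_mul_suf (h1.1 (by simp [FreeMonoid.mem_mul])))
  rw [FreeMonoid.reverse_reverse, FreeMonoid.reverse_mul, FreeMonoid.reverse_mul,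
    FreeMonoid.reverse_of, ← mul_assoc] at this
  exact this.symm

end Words

end PV

namespace PV

open scoped Pointwise

/-! ### Repeated factors in long products -/

section Pigeonhole

theorem exists_pow_isIdempotentElem {M : Type*} [Monoid M] [Finite M] (x : M) :
    ∃ n, 0 < n ∧ IsIdempotentElem (x ^ n) := by
  have hs : ∀ n, spow x n = x ^ (n + 1) := fun n => by
    induction n with
    | zero => simp [spow]
    | succ n ih => rw [pow_succ, ← ih]; rfl
  obtain ⟨n, hn⟩ := exists_idem_spow x
  rw [hs] at hn
  exact ⟨n + 1, n.succ_pos, hn⟩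

/-- There are `l.length + 1` prefixes, more than elements of `M`, so two prefix products coincide.
-/
theorem exists_prod_factor {M : Type*} [Monoid M] [Finite M] (l : List M)
    (hl : Nat.card M ≤ l.length) :
    ∃ l₁ l₂ l₃ : List M, l = l₁ ++ l₂ ++ l₃ ∧ l₂ ≠ [] ∧ l₁.prod * l₂.prod = l₁.prod := by
  obtain ⟨i, j, hij, h⟩ : ∃ i j : Fin (l.length + 1), i < j ∧
      (l.take i).prod = (l.take j).prod := by
    obtain ⟨i, j, hne, h⟩ : ∃ i j : Fin (l.length + 1), i ≠ j ∧
        (l.take i).prod = (l.take j).prod := by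
      by_contra hcon
      have hinj : Function.Injective fun i : Fin (l.length + 1) => (l.take i).prod := by
        intro i j hij
        by_contra hne
        exact hcon ⟨i, j, hne, hij⟩
      have := Nat.card_le_card_of_injective _ hinj
      rw [Nat.card_fin] at this
      omega
    rcases lt_or_gt_of_ne hne with hlt | hlt
    · exact ⟨i, j, hlt, h⟩
    · exact ⟨j, i, hlt, h.symm⟩
  have hij' : (i : ℕ) < j := hij
  have hj : (j : ℕ) ≤ l.length := Nat.lt_succ_iff.1 j.2
  have ht : l.take i ++ (l.take j).drop i = l.take j := by
    conv_rhs => rw [← List.take_append_drop i (l.take j), List.take_take, min_eq_left hij'.le]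
  refine ⟨l.take i, (l.take j).drop i, l.drop j, ?_, ?_, ?_⟩
  · rw [ht, List.take_append_drop]
  · intro hnil
    have := congrArg List.length hnil
    simp only [List.length_drop, List.length_take, List.length_nil] at this
    omega
  · rw [← List.prod_append, ht, h]

/-- A factor that the prefix product absorbs may be repeated at will, in particular until its power
is idempotent. This is used both in `N` and in the power monoid `Set N`. -/
theorem exists_prod_eq_mul_pow_mul {M : Type*} [Monoid M] [Finite M] (l : List M)
    (hl : Nat.card M ≤ l.length) :
    ∃ (l₁ l₂ l₃ : List M) (n : ℕ), l = l₁ ++ l₂ ++ l₃ ∧ l₂ ≠ [] ∧ 0 < n ∧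
      IsIdempotentElem (l₂.prod ^ n) ∧ l.prod = l₁.prod * l₂.prod ^ n * l₃.prod := by
  obtain ⟨l₁, l₂, l₃, h, hne, hp⟩ := exists_prod_factor l hl
  obtain ⟨n, hn, hi⟩ := exists_pow_isIdempotentElem l₂.prod
  have hpow : ∀ k, l₁.prod * l₂.prod ^ k = l₁.prod := fun k => by
    induction k with
    | zero => simp
    | succ k ih => rw [pow_succ, ← mul_assoc, ih, hp]
  exact ⟨l₁, l₂, l₃, n, h, hne, hn, hi, by rw [hpow, h, List.prod_append, List.prod_append, hp]⟩

theorem exists_list_of_idempotent_set {M : Type*} [Monoid M] {P : Set M}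
    (hP : IsIdempotentElem P) (k : ℕ) :
    ∀ s ∈ P, ∃ l : List M, l.length = k + 1 ∧ (∀ x ∈ l, x ∈ P) ∧ l.prod = s := by
  induction k with
  | zero => exact fun s hs => ⟨[s], rfl, by simpa using hs, by simp⟩
  | succ k ih =>
    intro s hs
    rw [← hP.eq] at hs
    obtain ⟨a, ha, b, hb, rfl⟩ := Set.mem_mul.1 hs
    obtain ⟨l, hl, hlP, rfl⟩ := ih b hb
    exact ⟨a :: l, by simp [hl], by simpa using ⟨ha, hlP⟩, by simp⟩

end Pigeonhole

theorem reverse_list_prod {A : Type*} (L : List (FreeMonoid A)) :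
    L.prod.reverse = (L.map FreeMonoid.reverse).reverse.prod := by
  induction L with
  | nil => rfl
  | cons x L ih => simp [FreeMonoid.reverse_mul, ih]

/-! ### Sets of elements represented by terms with a common value -/

section TermRelation

variable {A N E : Type*} {R : N → E → Finset A → Prop}

/-- All elements of `P` are represented by terms with letters `B` and a common value. -/
def HasCommonValue (R : N → E → Finset A → Prop) (B : Finset A) (P : Set N) : Prop :=
  ∃ e, ∀ s ∈ P, R s e B

theorem HasCommonValue.mono {B : Finset A} {P Q : Set N} (h : HasCommonValue R B P)
    (hQ : Q ⊆ P) : HasCommonValue R B Q :=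
  h.imp fun _ he s hs => he s (hQ hs)

variable [Monoid E]

/-- All elements of `P` are represented by terms with letters `B` and a common idempotent value. -/
def HasCommonIdempotentValue (R : N → E → Finset A → Prop) (B : Finset A) (P : Set N) : Prop :=
  ∃ e, ∀ s ∈ P, R s e B ∧ IsIdempotentElem e

theorem HasCommonIdempotentValue.hasCommonValue {B : Finset A} {P : Set N}
    (h : HasCommonIdempotentValue R B P) : HasCommonValue R B P :=
  h.imp fun _ he s hs => (he s hs).1

theorem HasCommonIdempotentValue.mono {B : Finset A} {P Q : Set N}
    (h : HasCommonIdempotentValue R B P) (hQ : Q ⊆ P) : HasCommonIdempotentValue R B Q :=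
  h.imp fun _ he s hs => he s (hQ hs)

variable [Monoid N] [DecidableEq A]

/-- The closure properties of the relation "`s` is the image of a term with value `e` whose set of
letters is `B`", where `ω` is an `ω`-power on values. -/
structure IsTermRelation (η : FreeMonoid A →* N) (ω : E → E) (R : N → E → Finset A → Prop) :
    Prop where
  one : R 1 1 ∅
  gen : ∀ a, ∃ e, R (η (FreeMonoid.of a)) e {a}
  mul : ∀ {s e B s' e' B'}, R s e B → R s' e' B' → R (s * s') (e * e') (B ∪ B')
  omega : ∀ {s e B n}, R s e B → 0 < n → IsIdempotentElem (s ^ n) → R (s ^ n) (ω e) B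
  omega_idem : ∀ e, IsIdempotentElem (ω e)
  omega_mul : ∀ e, ω e * e = ω e
  mul_omega : ∀ e, e * ω e = ω e
  omega_pow : ∀ e k, 0 < k → ω (e ^ k) = ω e
  absorb : ∀ {s f B s' g s'' z C}, R s f B → R s' g B → R s'' z C → C ⊆ B →
    IsIdempotentElem f → IsIdempotentElem g → f * z * g = f * g

variable {η : FreeMonoid A →* N} {ω : E → E}

/-! ### Common values of products and of idempotent sets. -/

namespace IsTermRelation

theorem word (hR : IsTermRelation η ω R) (w : FreeMonoid A) : ∃ e, R (η w) e w.symbols := by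
  induction w using FreeMonoid.inductionOn' with
  | one => exact ⟨1, by simpa using hR.one⟩
  | of_mul a w ih =>
    obtain ⟨e, he⟩ := ih
    obtain ⟨f, hf⟩ := hR.gen a
    exact ⟨f * e, by simpa using hR.mul hf he⟩

theorem hasCommonValue_mul (hR : IsTermRelation η ω R) {B C : Finset A} {P Q : Set N}
    (hP : HasCommonValue R B P) (hQ : HasCommonValue R C Q) : HasCommonValue R (B ∪ C) (P * Q) := by
  obtain ⟨e, he⟩ := hP
  obtain ⟨f, hf⟩ := hQ
  refine ⟨e * f, ?_⟩
  rintro _ ⟨s, hs, t, ht, rfl⟩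
  exact hR.mul (he s hs) (hf t ht)

theorem hasCommonValue_prod (hR : IsTermRelation η ω R) {B : Finset A} (L : List (Set N))
    (hL : ∀ P ∈ L, HasCommonValue R B P) :
    -- The empty product has no letters, so the letter set is `B` only for nonempty lists.
    ∃ C, C ⊆ B ∧ (L ≠ [] → C = B) ∧ HasCommonValue R C L.prod := by
  induction L with
  | nil => exact ⟨∅, by simp, by simp, 1, by simpa using hR.one⟩
  | cons P L ih =>
    rw [List.forall_mem_cons] at hL
    obtain ⟨C, hC, -, h⟩ := ih hL.2
    refine ⟨B, subset_rfl, fun _ => rfl, ?_⟩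
    have := hR.hasCommonValue_mul hL.1 h
    rwa [Finset.union_eq_left.2 hC] at this

theorem list_prod (hR : IsTermRelation η ω R) {B : Finset A} {e : E} (l : List N)
    (hl : ∀ s ∈ l, R s e B) : ∃ C, C ⊆ B ∧ (l ≠ [] → C = B) ∧ R l.prod (e ^ l.length) C := by
  induction l with
  | nil => exact ⟨∅, by simp, by simp, by simpa using hR.one⟩
  | cons s l ih =>
    rw [List.forall_mem_cons] at hl
    obtain ⟨C, hC, -, h⟩ := ih hl.2
    refine ⟨B, subset_rfl, fun _ => rfl, ?_⟩
    have := hR.mul hl.1 h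
    rwa [Finset.union_eq_left.2 hC, ← List.prod_cons, ← pow_succ', ← List.length_cons (a := s)]
      at this

theorem pow_mul_omega (hR : IsTermRelation η ω R) (e : E) (k : ℕ) : e ^ k * ω e = ω e := by
  induction k with
  | zero => simp
  | succ k ih => rw [pow_succ, mul_assoc, hR.mul_omega, ih]

theorem omega_mul_pow (hR : IsTermRelation η ω R) (e : E) (k : ℕ) : ω e * e ^ k = ω e := by
  induction k with
  | zero => simp
  | succ k ih => rw [pow_succ, ← mul_assoc, ih, hR.omega_mul]

/-- Since `P = P * P`, each element is an arbitrarily long product of elements of `P`. Some factor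
of it can be replaced by an idempotent power, and hence be represented by an `ω`-power. The value
becomes `e ^ i * ω (e ^ j) * e ^ k`, which collapses to `ω e` for every element of `P`. -/
theorem omega_of_idempotent_set [Finite N] (hR : IsTermRelation η ω R) {B : Finset A} {e : E}
    {P : Set N} (hP : IsIdempotentElem P) (he : ∀ s ∈ P, R s e B) : ∀ s ∈ P, R s (ω e) B := by
  intro s hs
  obtain ⟨l, hl, hlP, rfl⟩ := exists_list_of_idempotent_set hP (Nat.card N) s hs
  obtain ⟨l₁, l₂, l₃, n, h, hne, hn, hi, hp⟩ := exists_prod_eq_mul_pow_mul l (by omega)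
  obtain ⟨C₁, hC₁, -, h₁⟩ := hR.list_prod l₁ fun s hs => he s (hlP s (by simp [h, hs]))
  obtain ⟨C₂, -, hC₂, h₂⟩ := hR.list_prod l₂ fun s hs => he s (hlP s (by simp [h, hs]))
  obtain ⟨C₃, hC₃, -, h₃⟩ := hR.list_prod l₃ fun s hs => he s (hlP s (by simp [h, hs]))
  obtain rfl := hC₂ hne
  have := hR.mul (hR.mul h₁ (hR.omega h₂ hn hi)) h₃
  rwa [hR.omega_pow _ _ (List.length_pos_of_ne_nil hne), hR.pow_mul_omega, hR.omega_mul_pow,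
    Finset.union_eq_right.2 hC₁, Finset.union_eq_left.2 hC₃, ← hp] at this

/-- Pigeonhole in the finite monoid `Set N` rewrites the product with an idempotent set in the
middle, to which `omega_of_idempotent_set` applies. -/
theorem exists_idempotent_factor [Finite N] (hR : IsTermRelation η ω R) {B : Finset A}
    (L : List (Set N)) (hL : ∀ P ∈ L, HasCommonValue R B P) (hlen : Nat.card (Set N) ≤ L.length) :
    ∃ (X F Y : Set N) (C D : Finset A), L.prod = X * F * Y ∧ C ⊆ B ∧ D ⊆ B ∧
      HasCommonValue R C X ∧ HasCommonIdempotentValue R B F ∧ HasCommonValue R D Y := by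
  obtain ⟨l₁, l₂, l₃, n, h, hne, hn, hi, hp⟩ := exists_prod_eq_mul_pow_mul L hlen
  obtain ⟨C₁, hC₁, -, h₁⟩ := hR.hasCommonValue_prod l₁ fun s hs => hL s (by simp [h, hs])
  obtain ⟨C₂, -, hC₂, h₂⟩ := hR.hasCommonValue_prod l₂ fun s hs => hL s (by simp [h, hs])
  obtain ⟨C₃, hC₃, -, h₃⟩ := hR.hasCommonValue_prod l₃ fun s hs => hL s (by simp [h, hs])
  obtain rfl := hC₂ hne
  obtain ⟨C, -, hC, e, he⟩ := hR.hasCommonValue_prod (List.replicate n l₂.prod)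
    (B := C₂) fun s hs => by rw [List.eq_of_mem_replicate hs]; exact h₂
  rw [List.prod_replicate] at he
  obtain rfl := hC (by rw [Ne, List.replicate_eq_nil_iff]; omega)
  exact ⟨_, _, _, _, _, hp, hC₁, hC₃, h₁,
    ⟨ω e, fun s hs => ⟨hR.omega_of_idempotent_set hi he s hs, hR.omega_idem e⟩⟩, h₃⟩

theorem hasCommonIdempotentValue_sandwich [Finite N] (hR : IsTermRelation η ω R) {B : Finset A}
    (L L' : List (Set N)) (hL : ∀ P ∈ L, HasCommonValue R B P)
    (hL' : ∀ P ∈ L', HasCommonValue R B P) (hlen : Nat.card (Set N) ≤ L.length)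
    (hlen' : Nat.card (Set N) ≤ L'.length) {Z : Set N}
    (hZ : ∀ s ∈ Z, ∃ e C, C ⊆ B ∧ R s e C) :
    HasCommonIdempotentValue R B (L.prod * Z * L'.prod) := by
  obtain ⟨X, F, Y, C, D, hp, hC, hD, ⟨x, hX⟩, ⟨f, hF⟩, ⟨y, hY⟩⟩ :=
    hR.exists_idempotent_factor L hL hlen
  obtain ⟨X', G, Y', C', D', hp', hC', hD', ⟨x', hX'⟩, ⟨g, hG⟩, ⟨y', hY'⟩⟩ :=
    hR.exists_idempotent_factor L' hL' hlen'
  rw [hp, hp']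
  -- The values of `Y`, `Z` and `X'` lie between the idempotents `f` and `g` and are absorbed. This
  -- is why the elements of `Z` need no common value.
  refine ⟨x * f * g * y', ?_⟩
  rintro _ ⟨_, ⟨_, ⟨_, ⟨a, ha, b, hb, rfl⟩, c, hc, rfl⟩, z, hz, rfl⟩, _,
    ⟨_, ⟨a', ha', b', hb', rfl⟩, c', hc', rfl⟩, rfl⟩
  obtain ⟨e, K, hK, he⟩ := hZ z hz
  obtain ⟨hbf, hf⟩ := hF b hb
  obtain ⟨hbg, hg⟩ := hG b' hb'
  constructor
  · have hmid := hR.mul (hR.mul (hY c hc) he) (hX' a' ha')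
    have habs := hR.absorb hbf hbg hmid (by
      simp only [Finset.union_subset_iff]; exact ⟨⟨hD, hK⟩, hC'⟩) hf hg
    have := hR.mul (hR.mul (hR.mul (hR.mul (hX a ha) hbf) hmid) hbg) (hY' c' hc')
    have hset : C ∪ B ∪ (D ∪ K ∪ C') ∪ B ∪ D' = B := by
      apply subset_antisymm
      · simp only [Finset.union_subset_iff]
        exact ⟨⟨⟨⟨hC, subset_rfl⟩, ⟨hD, hK⟩, hC'⟩, subset_rfl⟩, hD'⟩
      · exact fun i hi => by simp [hi]
    rw [hset] at this
    have hval : x * f * (y * e * x') * g * y' = x * f * g * y' := by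
      rw [mul_assoc x f, mul_assoc x, habs, ← mul_assoc]
    rw [hval] at this
    simpa only [mul_assoc] using this
  -- In the square of `x * f * g * y'`, the part between the two copies of `g` is absorbed.
  · have habs := hR.absorb hbg hbg (hR.mul (hR.mul (hY' c' hc') (hX a ha)) hbf) (by
      simp only [Finset.union_subset_iff]; exact ⟨⟨hD', hC⟩, subset_rfl⟩) hg hg
    calc x * f * g * y' * (x * f * g * y') = x * f * (g * (y' * x * f) * g) * y' := by
          simp only [mul_assoc]
      _ = x * f * g * y' := by rw [habs, hg.eq]

end IsTermRelation

/-! ### Factorization of words by their full factors -/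

/-- A word has `k` disjoint factors containing all letters of `B`. -/
def HasFullFactors (B : Finset A) (k : ℕ) (w : FreeMonoid A) : Prop :=
  ∃ L : List (FreeMonoid A), L.length = k ∧ (∀ x ∈ L, B ⊆ x.symbols) ∧
    ∃ s t, w = s * L.prod * t

theorem HasFullFactors.subset {B : Finset A} {k : ℕ} {w : FreeMonoid A}
    (h : HasFullFactors B (k + 1) w) : B ⊆ w.symbols := by
  obtain ⟨L, hlen, hL, s, t, rfl⟩ := h
  obtain _ | ⟨x, L⟩ := L
  · simp at hlen
  · refine (hL x (by simp)).trans fun a ha => ?_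
    simp only [List.prod_cons, FreeMonoid.symbols_mul, Finset.mem_union]
    tauto

theorem symbols_reverse (w : FreeMonoid A) : w.reverse.symbols = w.symbols := by
  ext a
  rw [FreeMonoid.mem_symbols, FreeMonoid.mem_symbols, mem_reverse_word]

theorem HasFullFactors.reverse {B : Finset A} {k : ℕ} {w : FreeMonoid A}
    (h : HasFullFactors B k w) : HasFullFactors B k w.reverse := by
  obtain ⟨L, hlen, hL, s, t, rfl⟩ := h
  refine ⟨(L.map FreeMonoid.reverse).reverse, by simpa using hlen, ?_, t.reverse, s.reverse, ?_⟩
  · simpa [symbols_reverse] using hL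
  · rw [FreeMonoid.reverse_mul, FreeMonoid.reverse_mul, reverse_list_prod, mul_assoc]

/-- The first full factor contains `a`, so the first occurrence of `a` comes no later than the end
of that factor. Cutting there destroys at most one full factor. -/
theorem HasFullFactors.of_left {B : Finset A} {k : ℕ} {a : A} {u v : FreeMonoid A} (ha : a ∈ B)
    (hu : a ∉ u) (h : HasFullFactors B (k + 1) (u * FreeMonoid.of a * v)) :
    HasFullFactors B k v := by
  obtain ⟨L, hlen, hL, s, t, h⟩ := h
  obtain _ | ⟨x, L⟩ := L
  · simp at hlen
  · rw [List.forall_mem_cons] at hL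
    refine ⟨L, by simpa using hlen, hL.2, suf a (s * x), t, ?_⟩
    have hx : a ∈ s * x := FreeMonoid.mem_mul.2 (Or.inr (FreeMonoid.mem_symbols.1 (hL.1 ha)))
    rw [← suf_factor hu v, h, List.prod_cons, mul_assoc (suf a _), ← suf_mul_of_mem hx]
    simp only [mul_assoc]

theorem HasFullFactors.of_right {B : Finset A} {k : ℕ} {a : A} {u v : FreeMonoid A} (ha : a ∈ B)
    (hv : a ∉ v) (h : HasFullFactors B (k + 1) (u * FreeMonoid.of a * v)) :
    HasFullFactors B k u := by
  have := h.reverse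
  rw [FreeMonoid.reverse_mul, FreeMonoid.reverse_mul, FreeMonoid.reverse_of, ← mul_assoc] at this
  have := (HasFullFactors.of_left ha (fun k => hv (mem_reverse_word.1 k)) this).reverse
  rwa [FreeMonoid.reverse_reverse] at this

theorem exists_shortest_full_suffix {B : Finset A} (hB : B.Nonempty) (w : FreeMonoid A)
    (h : B ⊆ w.symbols) :
    ∃ u a v, w = u * FreeMonoid.of a * v ∧ a ∉ v ∧ a ∈ B ∧ B ⊆ insert a v.symbols := by
  induction w using FreeMonoid.inductionOn' with
  | one =>
    obtain ⟨b, hb⟩ := hB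
    simpa using h hb
  | of_mul b w ih =>
    by_cases hw : B ⊆ w.symbols
    · obtain ⟨u, a, v, rfl, h1, h2, h3⟩ := ih hw
      exact ⟨FreeMonoid.of b * u, a, v, by simp only [mul_assoc], h1, h2, h3⟩
    · obtain ⟨a, ha, haw⟩ := Finset.not_subset.1 hw
      have hab : a = b := by simpa [haw, FreeMonoid.mem_symbols] using h ha
      subst hab
      exact ⟨1, a, w, by simp, fun k => haw (FreeMonoid.mem_symbols.2 k), ha, by simpa using h⟩

theorem exists_shortest_full_prefix {B : Finset A} (hB : B.Nonempty) (w : FreeMonoid A)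
    (h : B ⊆ w.symbols) :
    ∃ u a v, w = u * FreeMonoid.of a * v ∧ a ∉ u ∧ a ∈ B ∧ B ⊆ insert a u.symbols := by
  obtain ⟨u, a, v, h1, h2, h3, h4⟩ :=
    exists_shortest_full_suffix hB w.reverse (by rwa [symbols_reverse])
  refine ⟨v.reverse, a, u.reverse, ?_, fun k => h2 (mem_reverse_word.1 k), h3, by
    rwa [symbols_reverse]⟩
  rw [← FreeMonoid.reverse_reverse (a := w), h1]
  simp only [FreeMonoid.reverse_mul, FreeMonoid.reverse_of, mul_assoc]

theorem iterate_splitCon_le (c : Con (FreeMonoid A)) (k : ℕ) : splitCon^[k] c ≤ c := by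
  induction k with
  | zero => exact le_rfl
  | succ k ih =>
    rw [Function.iterate_succ_apply']
    exact (splitCon_le _).trans ih

theorem IsDACon.iterate_splitCon [Finite A] {c : Con (FreeMonoid A)} (h : IsDACon c) (k : ℕ) :
    IsDACon (PV.splitCon^[k] c) := by
  induction k with
  | zero => exact h
  | succ k ih =>
    rw [Function.iterate_succ_apply']
    exact ih.splitCon

/-! ### Peeling full factors off a class, and the inductive construction of the congruence. -/

namespace IsTermRelation

theorem hasCommonValue_letter (hR : IsTermRelation η ω R) (a : A) :
    HasCommonValue R {a} {η (FreeMonoid.of a)} := by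
  obtain ⟨e, he⟩ := hR.gen a
  exact ⟨e, by simpa using he⟩

/-- Up to `k` shortest full prefixes are peeled off, each using one layer of `splitCon`. Either the
letters of `B` run out first, or `k` blocks with common values are obtained, uniformly over the
class, with remainders still congruent modulo `c`. The clause on full factors of `z` records that
`k` peelings cost at most `k` full factors. -/
theorem split_left (hR : IsTermRelation η ω R) {B : Finset A} (hB : B.Nonempty)
    {c₀ : Con (FreeMonoid A)}
    (h₀ : ∀ w, w.symbols ⊂ B → HasCommonValue R w.symbols (η '' {v | c₀ w v}))
    {c : Con (FreeMonoid A)} (hc : c ≤ c₀) (k : ℕ) : ∀ w, w.symbols ⊆ B →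
    (HasCommonValue R w.symbols (η '' {v | splitCon^[k] c w v}) ∧ ¬ HasFullFactors B k w) ∨
    ∃ L : List (Set N), L.length = k ∧ (∀ P ∈ L, HasCommonValue R B P) ∧ ∃ z, z.symbols ⊆ B ∧
      (∀ j, HasFullFactors B (j + k) w → HasFullFactors B j z) ∧
      ∀ v, splitCon^[k] c w v → ∃ p ∈ L.prod, ∃ v', c z v' ∧ η v = p * η v' := by
  induction k with
  | zero =>
    exact fun w hw => Or.inr ⟨[], rfl, by simp, w, hw, fun j hj => hj, fun v hv =>
      ⟨1, by simp, v, hv, by simp⟩⟩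
  | succ k ih =>
    intro w hw
    rcases hw.eq_or_ssubset with hwB | hwB
    swap
    · refine Or.inl ⟨(h₀ w hwB).mono (Set.image_mono fun v hv => ?_), fun h => hwB.2 h.subset⟩
      exact hc (iterate_splitCon_le c (k + 1) hv)
    -- The letter `a` completes `B` for the first time, so `u` has strictly fewer letters and `h₀`
    -- applies to it.
    obtain ⟨u, a, w', rfl, hau, haB, hBu⟩ := exists_shortest_full_prefix hB w hwB.superset
    have hsym : u.symbols ∪ {a} ∪ w'.symbols = B := by simpa using hwB
    have hu : u.symbols ⊆ B := by
      rw [← hsym, Finset.union_assoc]; exact Finset.subset_union_left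
    have hu' : u.symbols ⊂ B :=
      ⟨hu, fun h => hau (FreeMonoid.mem_symbols.1 (h haB))⟩
    have hua : u.symbols ∪ {a} = B := by
      apply subset_antisymm
      · exact Finset.union_subset hu (by simpa using haB)
      · rwa [Finset.union_comm, ← Finset.insert_eq]
    have hw' : w'.symbols ⊆ B := by rw [← hsym]; exact Finset.subset_union_right
    have hgood : HasCommonValue R B
        (η '' {v | splitCon^[k] c u v} * {η (FreeMonoid.of a)}) := by
      rw [← hua]
      refine hR.hasCommonValue_mul ((h₀ u hu').mono (Set.image_mono fun v hv => ?_))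
        (hR.hasCommonValue_letter a)
      exact hc (iterate_splitCon_le c k hv)
    rw [Function.iterate_succ_apply']
    rcases ih w' hw' with ⟨h1, h2⟩ | ⟨L, hlen, hL, z, hz, hfull, hsplit⟩
    · refine Or.inl ⟨?_, fun h => h2 (h.of_left haB hau)⟩
      rw [hwB, ← Finset.union_eq_left.2 hw']
      refine (hR.hasCommonValue_mul hgood h1).mono ?_
      rintro _ ⟨v, hv, rfl⟩
      obtain ⟨v₀, v₁, rfl, hv₀, hv₁⟩ := splitCon_left hau hv
      rw [map_mul, map_mul]
      exact Set.mul_mem_mul (Set.mul_mem_mul ⟨v₀, hv₀, rfl⟩ rfl) ⟨v₁, hv₁, rfl⟩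
    · refine Or.inr ⟨_ :: L, by simp [hlen], List.forall_mem_cons.2 ⟨hgood, hL⟩, z, hz,
        fun j hj => hfull j (HasFullFactors.of_left haB hau hj), fun v hv => ?_⟩
      obtain ⟨v₀, v₁, rfl, hv₀, hv₁⟩ := splitCon_left hau hv
      obtain ⟨p, hp, v', hv', h⟩ := hsplit v₁ hv₁
      refine ⟨η v₀ * η (FreeMonoid.of a) * p, ?_, v', hv', ?_⟩
      · rw [List.prod_cons]
        exact Set.mul_mem_mul (Set.mul_mem_mul ⟨v₀, hv₀, rfl⟩ rfl) hp
      · simp only [map_mul, h, mul_assoc]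

theorem split_right (hR : IsTermRelation η ω R) {B : Finset A} (hB : B.Nonempty)
    {c₀ : Con (FreeMonoid A)}
    (h₀ : ∀ w, w.symbols ⊂ B → HasCommonValue R w.symbols (η '' {v | c₀ w v}))
    {c : Con (FreeMonoid A)} (hc : c ≤ c₀) (k : ℕ) : ∀ w, w.symbols ⊆ B →
    (HasCommonValue R w.symbols (η '' {v | splitCon^[k] c w v}) ∧ ¬ HasFullFactors B k w) ∨
    ∃ L : List (Set N), L.length = k ∧ (∀ P ∈ L, HasCommonValue R B P) ∧ ∃ z, z.symbols ⊆ B ∧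
      ∀ v, splitCon^[k] c w v → ∃ p ∈ L.prod, ∃ v', c z v' ∧ η v = η v' * p := by
  induction k with
  | zero =>
    exact fun w hw => Or.inr ⟨[], rfl, by simp, w, hw, fun v hv =>
      ⟨1, by simp, v, hv, by simp⟩⟩
  | succ k ih =>
    intro w hw
    rcases hw.eq_or_ssubset with hwB | hwB
    swap
    · refine Or.inl ⟨(h₀ w hwB).mono (Set.image_mono fun v hv => ?_), fun h => hwB.2 h.subset⟩
      exact hc (iterate_splitCon_le c (k + 1) hv)
    obtain ⟨w', a, u, rfl, hau, haB, hBu⟩ := exists_shortest_full_suffix hB w hwB.superset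
    have hsym : w'.symbols ∪ {a} ∪ u.symbols = B := by simpa using hwB
    have hu : u.symbols ⊆ B := by rw [← hsym]; exact Finset.subset_union_right
    have hu' : u.symbols ⊂ B :=
      ⟨hu, fun h => hau (FreeMonoid.mem_symbols.1 (h haB))⟩
    have hua : {a} ∪ u.symbols = B := by
      apply subset_antisymm
      · exact Finset.union_subset (by simpa using haB) hu
      · rwa [← Finset.insert_eq]
    have hw' : w'.symbols ⊆ B := by
      rw [← hsym, Finset.union_assoc]; exact Finset.subset_union_left
    have hgood : HasCommonValue R B
        ({η (FreeMonoid.of a)} * η '' {v | splitCon^[k] c u v}) := by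
      rw [← hua]
      refine hR.hasCommonValue_mul (hR.hasCommonValue_letter a)
        ((h₀ u hu').mono (Set.image_mono fun v hv => ?_))
      exact hc (iterate_splitCon_le c k hv)
    rw [Function.iterate_succ_apply']
    rcases ih w' hw' with ⟨h1, h2⟩ | ⟨L, hlen, hL, z, hz, hsplit⟩
    · refine Or.inl ⟨?_, fun h => h2 (h.of_right haB hau)⟩
      rw [hwB, ← Finset.union_eq_right.2 hw']
      refine (hR.hasCommonValue_mul h1 hgood).mono ?_
      rintro _ ⟨v, hv, rfl⟩
      obtain ⟨v₀, v₁, rfl, hv₀, hv₁⟩ := splitCon_right hau hv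
      rw [map_mul, map_mul, mul_assoc]
      exact Set.mul_mem_mul ⟨v₀, hv₀, rfl⟩ (Set.mul_mem_mul rfl ⟨v₁, hv₁, rfl⟩)
    · refine Or.inr ⟨L ++ [_], by simp [hlen], List.forall_mem_append.2
        ⟨hL, List.forall_mem_singleton.2 hgood⟩, z, hz, fun v hv => ?_⟩
      obtain ⟨v₀, v₁, rfl, hv₀, hv₁⟩ := splitCon_right hau hv
      obtain ⟨p, hp, v', hv', h⟩ := hsplit v₀ hv₀
      refine ⟨p * (η (FreeMonoid.of a) * η v₁), ?_, v', hv', ?_⟩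
      · rw [List.prod_append, List.prod_singleton]
        exact Set.mul_mem_mul hp (Set.mul_mem_mul rfl ⟨v₁, hv₁, rfl⟩)
      · simp only [map_mul, h, mul_assoc]

/-- With `k` the number of subsets of `N`, `k` layers of `splitCon` serve the peeling on the left
and `k` more the peeling on the right; `k` blocks on a side suffice for the pigeonhole argument. -/
theorem exists_con [Finite A] [Finite N] (hR : IsTermRelation η ω R) (n : ℕ) :
    ∃ c : Con (FreeMonoid A), IsDACon c ∧ (∀ u v, c u v → u.symbols = v.symbols) ∧
      ∀ w, w.symbols.card ≤ n → HasCommonValue R w.symbols (η '' {v | c w v}) ∧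
        (c (w * w) w → HasCommonIdempotentValue R w.symbols (η '' {v | c w v})) := by
  induction n with
  | zero =>
    -- Even over the trivial congruence, `splitCon` records the set of letters, so the empty word is
    -- alone in its class.
    refine ⟨splitCon ⊤, isDACon_top.splitCon, fun u v => splitCon_symbols, fun w hw => ?_⟩
    have h : HasCommonIdempotentValue R w.symbols (η '' {v | splitCon ⊤ w v}) := by
      have hw0 : w.symbols = ∅ := by simpa using hw
      refine ⟨1, ?_⟩
      rintro _ ⟨v, hv, rfl⟩
      have hv0 : v.symbols = ∅ := by rw [← splitCon_symbols hv, hw0]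
      have hv1 : v = 1 := List.toFinset_eq_empty_iff (l := v.toList) |>.1 hv0
      rw [hw0, hv1, map_one]
      exact ⟨hR.one, one_mul 1⟩
    exact ⟨h.hasCommonValue, fun _ => h⟩
  | succ n ih =>
    obtain ⟨c₀, hc₀, hsym₀, h₀⟩ := ih
    set k := Nat.card (Set N) with hk
    have hk0 : 0 < k := Nat.card_pos
    set c₁ := splitCon^[k] c₀ with hc₁
    set c₂ := splitCon^[k] c₁ with hc₂
    have hle₁ : c₁ ≤ c₀ := iterate_splitCon_le c₀ k
    have hle : c₂ ≤ c₀ := (iterate_splitCon_le c₁ k).trans hle₁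
    refine ⟨c₂, (hc₀.iterate_splitCon k).iterate_splitCon k, fun u v h => hsym₀ u v (hle h), ?_⟩
    intro w hw
    rcases Nat.lt_or_ge n w.symbols.card with hlt | hge
    swap
    · have hsub : η '' {v | c₂ w v} ⊆ η '' {v | c₀ w v} := Set.image_mono fun v hv => hle hv
      exact ⟨(h₀ w hge).1.mono hsub, fun h => ((h₀ w hge).2 (hle h)).mono hsub⟩
    have hcard : w.symbols.card = n + 1 := by omega
    -- Stated for every `u` with the letters of `w`, because it is applied both to `w` and to `w ^
    -- (k + k)`.
    have key : ∀ u : FreeMonoid A, u.symbols = w.symbols →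
        HasCommonIdempotentValue R w.symbols (η '' {v | c₂ u v}) ∨
        (HasCommonValue R w.symbols (η '' {v | c₂ u v}) ∧
          ¬ HasFullFactors w.symbols (k + k) u) := by
      intro u hu
      have hne : w.symbols.Nonempty := by rw [← Finset.card_pos]; omega
      have hsmall : ∀ x : FreeMonoid A, x.symbols ⊂ w.symbols →
          HasCommonValue R x.symbols (η '' {v | c₀ x v}) := fun x hx =>
        (h₀ x (by have := Finset.card_lt_card hx; omega)).1
      rcases hR.split_left hne hsmall hle₁ k u hu.subset with
        ⟨h1, h2⟩ | ⟨L, hlen, hL, z, hz, hfull, hsplit⟩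
      · refine Or.inr ⟨hu ▸ h1, fun h => h2 ?_⟩
        obtain ⟨M, hMlen, hM, s, t, rfl⟩ := h
        refine ⟨M.take k, by simp [hMlen], fun x hx => hM x (List.mem_of_mem_take hx), s,
          (M.drop k).prod * t, ?_⟩
        rw [mul_assoc, mul_assoc, ← mul_assoc (M.take k).prod, List.prod_take_mul_prod_drop]
      obtain ⟨C, -, hC, hLC⟩ := hR.hasCommonValue_prod L hL
      obtain rfl := hC (by rintro rfl; simp at hlen; omega)
      rcases hR.split_right hne hsmall le_rfl k z hz with
        ⟨h1, h2⟩ | ⟨L', hlen', hL', z', hz', hsplit'⟩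
      · refine Or.inr ⟨?_, fun h => h2 (hfull k h)⟩
        rw [← Finset.union_eq_left.2 hz]
        refine (hR.hasCommonValue_mul hLC h1).mono ?_
        rintro _ ⟨v, hv, rfl⟩
        obtain ⟨p, hp, v', hv', h⟩ := hsplit v hv
        rw [h]
        exact Set.mul_mem_mul hp ⟨v', hv', rfl⟩
      · left
        refine (hR.hasCommonIdempotentValue_sandwich L L' hL hL' hlen.ge hlen'.ge
          (Z := η '' {v | v.symbols ⊆ w.symbols}) ?_).mono ?_
        · rintro _ ⟨v, hv, rfl⟩
          obtain ⟨e, he⟩ := hR.word v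
          exact ⟨e, _, hv, he⟩
        · rintro _ ⟨v, hv, rfl⟩
          obtain ⟨p, hp, v', hv', h⟩ := hsplit v hv
          obtain ⟨p', hp', v'', hv'', h'⟩ := hsplit' v' hv'
          rw [h, h', ← mul_assoc]
          refine Set.mul_mem_mul (Set.mul_mem_mul hp ⟨v'', ?_, rfl⟩) hp'
          change v''.symbols ⊆ _
          rw [← hsym₀ _ _ hv'']
          exact hz'
    refine ⟨(key w rfl).elim (fun h => h.hasCommonValue) And.left, fun hidem => ?_⟩
    have hpow : ∀ m, c₂ (w ^ (m + 1)) w := by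
      intro m
      induction m with
      | zero => rw [zero_add, pow_one]; exact c₂.refl w
      | succ m ihm =>
        rw [pow_succ]
        exact c₂.trans (c₂.mul ihm (c₂.refl w)) hidem
    have hkk : k + k = (k + k - 1) + 1 := by omega
    have hw2 : c₂ (w ^ (k + k)) w := hkk ▸ hpow (k + k - 1)
    have hset : {v | c₂ w v} = {v | c₂ (w ^ (k + k)) v} := by
      ext v
      exact ⟨fun h => c₂.trans hw2 h, fun h => c₂.trans (c₂.symm hw2) h⟩
    rw [hset]
    -- The power `w ^ (k + k)` has `k + k` full factors, namely its copies of `w`, so the peeling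
    -- cannot run out on either side.
    refine (key _ (hsym₀ _ _ (hle hw2))).resolve_right fun h => h.2 ?_
    exact ⟨List.replicate (k + k) w, by simp, fun x hx => by rw [List.eq_of_mem_replicate hx],
      1, 1, by simp⟩

end IsTermRelation

end TermRelation

end PV

namespace PV

/-! ### Idempotent powers in monoids -/

section OmegaPowers

variable {M : Type*} [Monoid M]

/-- `y` is an idempotent power of `x` with positive exponent. -/
def IsOmegaPow (x y : M) : Prop := IsIdempotentElem y ∧ ∃ n, 0 < n ∧ y = x ^ n

theorem IsOmegaPow.unique {x y z : M} (hy : IsOmegaPow x y) (hz : IsOmegaPow x z) : y = z := by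
  obtain ⟨hy, n, hn, hyn⟩ := hy
  obtain ⟨hz, m, hm, hzm⟩ := hz
  obtain ⟨n, rfl⟩ := Nat.exists_eq_succ_of_ne_zero hn.ne'
  obtain ⟨m, rfl⟩ := Nat.exists_eq_succ_of_ne_zero hm.ne'
  rw [← hy.pow_succ_eq m, ← hz.pow_succ_eq n, hyn, hzm, ← pow_mul, ← pow_mul, mul_comm]

theorem IsOmegaPow.of_pow {x y : M} {k : ℕ} (hk : 0 < k) (h : IsOmegaPow (x ^ k) y) :
    IsOmegaPow x y := by
  obtain ⟨h, n, hn, rfl⟩ := h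
  exact ⟨h, k * n, Nat.mul_pos hk hn, (pow_mul x k n).symm⟩

theorem IsOmegaPow.mul_comm_self {x y : M} (h : IsOmegaPow x y) : y * x = x * y := by
  obtain ⟨-, n, -, rfl⟩ := h
  rw [← pow_succ, ← pow_succ']

/-- Aperiodicity: `x` divides its idempotent power `y`, so `y * x * y = y`, and `x` commutes with
`y`. -/
theorem IsOmegaPow.mul_self (hM : ∀ x : M, IsRegularElem x → IsIdempotentElem x) {x y : M}
    (h : IsOmegaPow x y) : y * x = y := by
  have hc := h.mul_comm_self
  obtain ⟨hy, n, hn, hyn⟩ := h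
  obtain ⟨n, rfl⟩ := Nat.exists_eq_succ_of_ne_zero hn.ne'
  have := sandwich_of_dvd hM hy (a := x) (x := 1) (y := x ^ n)
    (by rw [hyn, one_mul, Nat.succ_eq_add_one, pow_succ'])
  rwa [hc, mul_assoc, hy.eq, ← hc] at this

theorem withOne_regular_idempotent {T : Type*} [Semigroup T]
    (hT : ∀ x : T, IsRegularElem x → IsIdempotentElem x) (x : WithOne T) (hx : IsRegularElem x) :
    IsIdempotentElem x := by
  obtain ⟨y, h⟩ := hx
  induction x with
  | one => exact one_mul 1
  | coe x =>
    induction y with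
    | one => rwa [mul_one] at h
    | coe y => exact congrArg WithOne.coe (hT x ⟨y, WithOne.coe_injective h⟩)

theorem coe_spow {T : Type*} [Semigroup T] (x : T) (n : ℕ) :
    ((spow x n : T) : WithOne T) = (x : WithOne T) ^ (n + 1) := by
  induction n with
  | zero => simp [spow]
  | succ n ih => rw [pow_succ, ← ih]; rfl

theorem isOmegaPow_coe {T : Type*} [Semigroup T] [Finite T] (x : T) :
    IsOmegaPow (x : WithOne T) (omegaPow x : T) :=
  ⟨congrArg WithOne.coe (omegaPow_idem x), _, Nat.succ_pos _, coe_spow x _⟩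

end OmegaPowers

/-! ### Free pro-`V` semigroups -/

namespace FreePro

variable {V : Pseudovariety.{v}} {A : Type v}

/-- The projection to a finite quotient. -/
def component (c : VCon V A) : FreePro V A →ₙ* c.1.Quotient where
  toFun x := x.1 c
  map_mul' _ _ := rfl

/-- The `ω`-power. -/
noncomputable def omega (x : FreePro V A) : FreePro V A :=
  ⟨fun c => haveI : Finite c.1.Quotient := V.finite _ c.2; omegaPow (x.1 c), fun c d h => by
    have : Finite c.1.Quotient := V.finite _ c.2
    have : Finite d.1.Quotient := V.finite _ d.2
    exact (map_omegaPow (quotMap h) _).trans (congrArg omegaPow (x.2 c d h))⟩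

/-- The projection to a finite quotient, with identities adjoined. -/
def component₁ (c : VCon V A) : WithOne (FreePro V A) →* WithOne c.1.Quotient :=
  WithOne.mapMulHom (component c)

/-- The `ω`-power, extended to an adjoined identity. -/
noncomputable def omega₁ (x : WithOne (FreePro V A)) : WithOne (FreePro V A) :=
  WithOne.recOneCoe 1 (fun y => ((omega y : FreePro V A) : WithOne (FreePro V A))) x

theorem omega₁_coe (x : FreePro V A) : omega₁ (x : WithOne (FreePro V A)) = (omega x : FreePro V A) :=
  rfl

theorem isOmegaPow_component₁ (c : VCon V A) (x : WithOne (FreePro V A)) :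
    IsOmegaPow (component₁ c x) (component₁ c (omega₁ x)) := by
  have : Finite c.1.Quotient := V.finite _ c.2
  induction x with
  | one => exact ⟨one_mul 1, 1, one_pos, by simp [omega₁]⟩
  | coe x => exact isOmegaPow_coe (x.1 c)

/-- At least one component is needed to separate the adjoined identity from the other elements. -/
theorem ext₁ [Nonempty (VCon V A)] {x y : WithOne (FreePro V A)}
    (h : ∀ c, component₁ c x = component₁ c y) : x = y := by
  obtain ⟨c₀⟩ := ‹Nonempty (VCon V A)›
  induction x with
  | one =>
    induction y with
    | one => rfl
    | coe y => exact absurd (h c₀) WithOne.one_ne_coe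
  | coe x =>
    induction y with
    | one => exact absurd (h c₀) WithOne.coe_ne_one
    | coe y => exact congrArg WithOne.coe (FreePro.ext fun c => WithOne.coe_injective (h c))

/-- The natural homomorphism from words to a quotient of the free semigroup, with an identity
adjoined. -/
def wordHom (c : Con (FreeSemigroup A)) : FreeMonoid A →* WithOne c.Quotient :=
  FreeMonoid.lift fun a => (((FreeSemigroup.of a : FreeSemigroup A) : c.Quotient) : WithOne _)

/-- Every finite quotient maps `x` to the class of a word with set of letters `B`. -/
def HasLetters [DecidableEq A] (x : WithOne (FreePro V A)) (B : Finset A) : Prop :=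
  ∀ c : VCon V A, ∃ w : FreeMonoid A, w.symbols = B ∧ wordHom c.1 w = component₁ c x

section HasLetters

variable [DecidableEq A]

theorem hasLetters_one : HasLetters (1 : WithOne (FreePro V A)) ∅ :=
  fun c => ⟨1, rfl, by rw [map_one, map_one]⟩

theorem hasLetters_of (a : A) : HasLetters (of V a : WithOne (FreePro V A)) {a} :=
  fun _ => ⟨FreeMonoid.of a, rfl, rfl⟩

theorem HasLetters.mul {x y : WithOne (FreePro V A)} {B C : Finset A} (hx : HasLetters x B)
    (hy : HasLetters y C) : HasLetters (x * y) (B ∪ C) := by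
  intro c
  obtain ⟨u, rfl, hu⟩ := hx c
  obtain ⟨w, rfl, hw⟩ := hy c
  exact ⟨u * w, FreeMonoid.symbols_mul, by rw [map_mul, map_mul, hu, hw]⟩

theorem symbols_pow (w : FreeMonoid A) {n : ℕ} (hn : 0 < n) : (w ^ n).symbols = w.symbols := by
  obtain ⟨n, rfl⟩ := Nat.exists_eq_succ_of_ne_zero hn.ne'
  induction n with
  | zero => simp
  | succ n ih => rw [pow_succ, FreeMonoid.symbols_mul, ih n.succ_pos, Finset.union_self]

theorem HasLetters.omega₁ {x : WithOne (FreePro V A)} {B : Finset A} (hx : HasLetters x B) :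
    HasLetters (omega₁ x) B := by
  intro c
  obtain ⟨u, rfl, hu⟩ := hx c
  obtain ⟨-, n, hn, h⟩ := isOmegaPow_component₁ c x
  exact ⟨u ^ n, symbols_pow u hn, by rw [map_pow, hu, h]⟩

end HasLetters

end FreePro

instance : Nonempty (VCon DA.{v} (A : Type v)) := by
  have : Subsingleton (⊤ : Con (FreeSemigroup A)).Quotient := ⟨fun x y => by
    induction x using Con.induction_on
    induction y using Con.induction_on
    exact (Con.eq _).2 trivial⟩
  exact ⟨⟨⊤, inferInstance, fun x _ => Subsingleton.elim _ _⟩⟩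

/-! ### Terms in the signature `ω` -/

section Terms

variable {A : Type v}

theorem interp_omegaWord (t : Fin 1 → FreeProfinite A) :
    interp omegaWord t = FreePro.omega (t 0) := by
  refine FreePro.ext fun c => ?_
  have : Finite c.1.Quotient := c.2
  have : Finite (evalCon fun b => (t b).1 c).1.Quotient := (evalCon fun b => (t b).1 c).2
  exact map_omegaPow (quotLift (evalCon fun b => (t b).1 c).1
    (FreeSemigroup.lift fun b => (t b).1 c) le_rfl) _

theorem IsTerm.mul {x y : FreeProfinite A} (hx : IsTerm omegaSignature A x)
    (hy : IsTerm omegaSignature A y) : IsTerm omegaSignature A (x * y) :=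
  IsTerm.app mulWord omegaSignature.mul_mem ![x, y] (Fin.forall_fin_two.2 ⟨hx, hy⟩)

theorem IsTerm.omega {x : FreeProfinite A} (hx : IsTerm omegaSignature A x) :
    IsTerm omegaSignature A (FreePro.omega x) := by
  have := IsTerm.app (σ := omegaSignature) omegaWord (Or.inr rfl) (fun _ => x) fun _ => hx
  rwa [interp_omegaWord] at this

/-- An `ω`-term or the adjoined identity. -/
def IsTermOrOne (x : WithOne (FreeProfinite A)) : Prop :=
  x = 1 ∨ ∃ y, IsTerm omegaSignature A y ∧ x = (y : WithOne (FreeProfinite A))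

theorem IsTermOrOne.mul {x y : WithOne (FreeProfinite A)} (hx : IsTermOrOne x)
    (hy : IsTermOrOne y) : IsTermOrOne (x * y) := by
  obtain rfl | ⟨x, hx, rfl⟩ := hx
  · rwa [one_mul]
  · obtain rfl | ⟨y, hy, rfl⟩ := hy
    · rw [mul_one]; exact Or.inr ⟨x, hx, rfl⟩
    · exact Or.inr ⟨x * y, hx.mul hy, rfl⟩

theorem IsTermOrOne.omega₁ {x : WithOne (FreeProfinite A)} (hx : IsTermOrOne x) :
    IsTermOrOne (FreePro.omega₁ x) := by
  obtain rfl | ⟨x, hx, rfl⟩ := hx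
  · exact Or.inl rfl
  · exact Or.inr ⟨_, hx.omega, rfl⟩

theorem proj_omega₁ (V : Pseudovariety.{v}) (x : WithOne (FreeProfinite A)) :
    WithOne.mapMulHom (proj V A) (FreePro.omega₁ x) =
      FreePro.omega₁ (WithOne.mapMulHom (proj V A) x) := by
  induction x with
  | one => rfl
  | coe x => rfl

end Terms

/-! ### Continuous homomorphisms and words -/

section Words

variable {A : Type v}

/-- The intersection of two congruences of finite index. -/
def infCon (c d : VCon allFinite A) : VCon allFinite A :=
  ⟨c.1 ⊓ d.1, finite_inf_quotient c.2 d.2⟩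

theorem component_eq_of_le {V : Pseudovariety.{v}} {c d : VCon V A} (h : c.1 ≤ d.1)
    {x y : FreePro V A} (hxy : x.1 c = y.1 c) : x.1 d = y.1 d := by
  rw [← x.2 c d h, ← y.2 c d h, hxy]

/-- Congruences of finite index are directed under intersection, so in the limit topology every
neighbourhood of a point contains one determined by a single component. -/
theorem exists_con_of_continuous {S : Type u} {φ : FreeProfinite A → S}
    (hφ : Continuous[inferInstance, ⊥] φ) (x : FreeProfinite A) :
    ∃ c : VCon allFinite A, ∀ y : FreeProfinite A, y.1 c = x.1 c → φ y = φ x := by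
  have : Nonempty (VCon allFinite A) := ⟨evalCon fun _ => PUnit.unit.{1}⟩
  have hnhds : 𝓝 x = ⨅ c : VCon allFinite A, Filter.principal {y | y.1 c = x.1 c} := by
    change @nhds _ (⨅ c : VCon allFinite A, TopologicalSpace.induced (fun x => x.1 c) ⊥) x = _
    rw [nhds_iInf]
    refine iInf_congr fun c => ?_
    rw [@nhds_induced _ _ ⊥, @nhds_discrete _ ⊥ (@DiscreteTopology.mk _ ⊥ rfl), Filter.comap_pure]
    rfl
  have hdir : Directed (· ≥ ·) fun c : VCon allFinite A =>
      {y : FreeProfinite A | y.1 c = x.1 c} := fun c d =>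
    ⟨infCon c d, fun y hy => component_eq_of_le (c := infCon c d) (d := c) inf_le_left hy,
      fun y hy => component_eq_of_le (c := infCon c d) (d := d) inf_le_right hy⟩
  have hmem : {y | φ y = φ x} ∈ 𝓝 x := by
    let : TopologicalSpace S := ⊥
    have : DiscreteTopology S := ⟨rfl⟩
    exact hφ.continuousAt (show ({φ x} : Set S) ∈ 𝓝 (φ x) by rw [nhds_discrete]; exact rfl)
  rw [hnhds, (Filter.hasBasis_iInf_principal hdir).mem_iff] at hmem
  obtain ⟨c, -, hc⟩ := hmem
  exact ⟨c, fun y hy => hc hy⟩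

/-- The natural homomorphism from the free semigroup to the free profinite semigroup. -/
def ofWord : FreeSemigroup A →ₙ* FreeProfinite A := FreeSemigroup.lift (FreePro.of allFinite)

theorem ofWord_component (c : VCon allFinite A) (u : FreeSemigroup A) :
    (ofWord u).1 c = (u : c.1.Quotient) := by
  have : (FreePro.component c).comp ofWord = c.1.mkMulHom := FreeSemigroup.hom_ext rfl
  exact DFunLike.congr_fun this u

/-- The natural homomorphism from the free semigroup to the free monoid. -/
def toFreeMonoid : FreeSemigroup A →ₙ* FreeMonoid A := FreeSemigroup.lift FreeMonoid.of

theorem exists_word_of_continuous {S : Type u} {φ : FreeProfinite A → S}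
    (hφ : Continuous[inferInstance, ⊥] φ) (x : FreeProfinite A) (c : VCon allFinite A) :
    ∃ u : FreeSemigroup A, φ (ofWord u) = φ x ∧ (u : c.1.Quotient) = x.1 c := by
  obtain ⟨d, hd⟩ := exists_con_of_continuous hφ x
  obtain ⟨u, hu⟩ := Quotient.exists_rep (x.1 (infCon c d))
  have hux : (ofWord u).1 (infCon c d) = x.1 (infCon c d) := (ofWord_component _ u).trans hu
  refine ⟨u, hd _ (component_eq_of_le (c := infCon c d) (d := d) inf_le_right hux), ?_⟩
  rw [← ofWord_component]
  exact component_eq_of_le (c := infCon c d) (d := c) inf_le_left hux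

theorem map_omega_of_continuous {S : Type u} [Semigroup S] [Finite S] {φ : FreeProfinite A →ₙ* S}
    (hφ : Continuous[inferInstance, ⊥] φ) (x : FreeProfinite A) :
    φ (FreePro.omega x) = omegaPow (φ x) := by
  let h : FreeSemigroup A →ₙ* S := φ.comp ofWord
  let c : VCon allFinite A := ⟨Con.ker h, finite_quotient_ker h⟩
  have : Finite c.1.Quotient := c.2
  -- By density of words, `φ` factors through the quotient by the kernel of its restriction to
  -- words; there the `ω`-power is a power in a finite semigroup.
  have hfac : ∀ y : FreeProfinite A, φ y = quotLift c.1 h le_rfl (y.1 c) := by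
    intro y
    obtain ⟨u, hu, huc⟩ := exists_word_of_continuous hφ y c
    rw [← hu, ← huc]
    rfl
  rw [hfac, hfac]
  exact map_omegaPow _ _

end Words

/-! ### Reducibility -/

section Reducibility

variable {A : Type v} {S : Type u} [Semigroup S]

/-- The element `s` is the image under `φ` of an `ω`-term with value `e` over `DA` and with set of
letters `B`. -/
def TermRelation [DecidableEq A] (φ : FreeProfinite A →ₙ* S) (s : WithOne S)
    (e : WithOne (FreePro DA A)) (B : Finset A) : Prop :=
  ∃ t, IsTermOrOne t ∧ WithOne.mapMulHom φ t = s ∧ WithOne.mapMulHom (proj DA A) t = e ∧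
    FreePro.HasLetters e B

/-- The extension to words of the values of `φ` on letters. -/
def wordValue (φ : FreeProfinite A →ₙ* S) : FreeMonoid A →* WithOne S :=
  FreeMonoid.lift fun a => (φ (FreePro.of allFinite a) : WithOne S)

theorem wordValue_toFreeMonoid (φ : FreeProfinite A →ₙ* S) (u : FreeSemigroup A) :
    wordValue φ (toFreeMonoid u) = (φ (ofWord u) : S) := by
  have : (wordValue φ : FreeMonoid A →ₙ* WithOne S).comp toFreeMonoid =
      WithOne.coeMulHom.comp (φ.comp ofWord) := FreeSemigroup.hom_ext rfl
  exact DFunLike.congr_fun this u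

theorem DA_withOne_quotient (c : VCon DA.{v} A) (x : WithOne c.1.Quotient)
    (hx : IsRegularElem x) : IsIdempotentElem x :=
  withOne_regular_idempotent c.2.2 x hx

theorem isTermRelation [DecidableEq A] [Finite S] {φ : FreeProfinite A →ₙ* S}
    (hφ : Continuous[inferInstance, ⊥] φ) :
    IsTermRelation (wordValue φ) FreePro.omega₁ (TermRelation φ) where
  one := ⟨1, Or.inl rfl, map_one _, map_one _, FreePro.hasLetters_one⟩
  gen a := ⟨_, FreePro.of allFinite a, Or.inr ⟨_, IsTerm.of a, rfl⟩, rfl, rfl,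
    FreePro.hasLetters_of a⟩
  mul := by
    rintro _ _ B _ _ B' ⟨t, ht, rfl, rfl, hB⟩ ⟨t', ht', rfl, rfl, hB'⟩
    exact ⟨t * t', ht.mul ht', map_mul _ _ _, map_mul _ _ _, hB.mul hB'⟩
  omega := by
    rintro _ _ B n ⟨t, ht, rfl, rfl, hB⟩ hn hi
    refine ⟨FreePro.omega₁ t, ht.omega₁, ?_, proj_omega₁ DA t, hB.omega₁⟩
    refine IsOmegaPow.unique (x := WithOne.mapMulHom φ t) ?_ ⟨hi, n, hn, rfl⟩
    induction t with
    | one => exact ⟨one_mul 1, 1, one_pos, by simp [FreePro.omega₁]⟩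
    | coe x =>
      rw [FreePro.omega₁_coe, WithOne.mapMulHom_coe, WithOne.mapMulHom_coe,
        map_omega_of_continuous hφ]
      exact isOmegaPow_coe (φ x)
  omega_idem e := FreePro.ext₁ fun c => by
    rw [map_mul, (FreePro.isOmegaPow_component₁ c e).1.eq]
  omega_mul e := FreePro.ext₁ fun c => by
    rw [map_mul, (FreePro.isOmegaPow_component₁ c e).mul_self (DA_withOne_quotient c)]
  mul_omega e := FreePro.ext₁ fun c => by
    rw [map_mul, ← (FreePro.isOmegaPow_component₁ c e).mul_comm_self,
      (FreePro.isOmegaPow_component₁ c e).mul_self (DA_withOne_quotient c)]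
  omega_pow e k hk := FreePro.ext₁ fun c => by
    have h := FreePro.isOmegaPow_component₁ c (e ^ k)
    rw [map_pow] at h
    exact (h.of_pow hk).unique (FreePro.isOmegaPow_component₁ c e)
  absorb := by
    rintro _ f B _ g _ z C ⟨-, -, -, -, hf⟩ ⟨-, -, -, -, hg⟩ ⟨-, -, -, -, hz⟩ hC hfi hgi
    refine FreePro.ext₁ fun c => ?_
    obtain ⟨u, hu, hfu⟩ := hf c
    obtain ⟨v, hv, hgv⟩ := hg c
    obtain ⟨w, hw, hzw⟩ := hz c
    have hfi' := hfi.map (FreePro.component₁ c)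
    have hgi' := hgi.map (FreePro.component₁ c)
    simp only [map_mul]
    rw [← hfu] at hfi' ⊢
    rw [← hgv] at hgi' ⊢
    rw [← hzw]
    exact sandwich_word_pair (DA_withOne_quotient c) _ hfi' hgi' (hu.trans hv.symm)
      (by rw [hw, hu]; exact hC)

/-- The quotient of the free semigroup by the restricted congruence embeds in the quotient of the
free monoid, so it is again in `DA`. -/
theorem IsDACon.exists_vCon {c : Con (FreeMonoid A)} (hc : IsDACon c) :
    ∃ d : VCon DA.{v} A, ∀ u v, d.1 u v ↔ c (toFreeMonoid u) (toFreeMonoid v) := by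
  have := hc.finite
  let g : FreeSemigroup A →ₙ* c.Quotient := (c.mk' : FreeMonoid A →ₙ* c.Quotient).comp toFreeMonoid
  have hinj : Function.Injective (quotLift (Con.ker g) g le_rfl) := by
    intro p q h
    induction p using Con.induction_on
    induction q using Con.induction_on
    exact (Con.eq _).2 h
  exact ⟨⟨Con.ker g, DA.sub_mem _ _ _ hinj ⟨hc.finite, hc.quotient⟩⟩, fun u v => Con.eq c⟩

theorem exists_terms_of_witness [Finite A] [Finite S] {φ : FreeProfinite A →ₙ* S}
    (hφ : Continuous[inferInstance, ⊥] φ) {P : Set S} {P' : Set (FreeProfinite A)}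
    {e : FreePro DA A} (hP : φ '' P' = P) (he : proj DA A '' P' = {e}) :
    ∃ (Q : Set (FreeProfinite A)) (f : FreePro DA A), (∀ x ∈ Q, IsTerm omegaSignature A x) ∧
      φ '' Q = P ∧ proj DA A '' Q = {f} ∧ (IsIdempotentElem e → IsIdempotentElem f) := by
  classical
  have := Fintype.ofFinite A
  have : Finite (WithOne S) := inferInstanceAs (Finite (Option S))
  obtain ⟨c, hc, -, h⟩ := (isTermRelation hφ).exists_con (Fintype.card A)
  obtain ⟨d, hd⟩ := hc.exists_vCon
  obtain ⟨w, hw⟩ := Quotient.exists_rep (e.1 d)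
  obtain ⟨h₁, h₂⟩ := h (toFreeMonoid w) (Finset.card_le_univ _)
  -- Each element of the witness is replaced by a word with the same image under `φ` in the class of
  -- `w`, where `w` represents the component of `e` at `d`.
  have hsub : ∀ s ∈ P, (s : WithOne S) ∈ wordValue φ '' {v | c (toFreeMonoid w) v} := by
    rw [← hP]
    rintro _ ⟨x, hx, rfl⟩
    have hxe : proj DA A x = e := by
      have : proj DA A x ∈ proj DA A '' P' := ⟨x, hx, rfl⟩
      rwa [he] at this
    obtain ⟨u, hu, hud⟩ := exists_word_of_continuous hφ x ⟨d.1, d.2.1⟩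
    refine ⟨toFreeMonoid u, (hd w u).1 ((Con.eq d.1).1 ?_), ?_⟩
    · refine hw.trans ?_
      rw [hud, ← hxe]
      rfl
    · rw [wordValue_toFreeMonoid, hu]
  obtain ⟨f, hf, hfi⟩ : ∃ f, (∀ s ∈ P, TermRelation φ s f (toFreeMonoid w).symbols) ∧
      (IsIdempotentElem e → ∀ s ∈ P, IsIdempotentElem f) := by
    by_cases hi : IsIdempotentElem e
    · obtain ⟨f, hf⟩ := h₂ (by
        rw [← map_mul]
        refine (hd (w * w) w).1 ((Con.eq d.1).1 ?_)
        have hee := congrArg (fun y : FreePro DA A => y.1 d) hi.eq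
        rw [Con.coe_mul]
        change ((w : d.1.Quotient)) = e.1 d at hw
        rw [hw]
        exact hee)
      exact ⟨f, fun s hs => (hf _ (hsub s hs)).1, fun _ s hs => (hf _ (hsub s hs)).2⟩
    · obtain ⟨f, hf⟩ := h₁
      exact ⟨f, fun s hs => hf _ (hsub s hs), fun k => absurd k hi⟩
  have hterm : ∀ s ∈ P, ∃ x, IsTerm omegaSignature A x ∧ φ x = s ∧
      ((proj DA A x : FreePro DA A) : WithOne (FreePro DA A)) = f := by
    intro s hs
    obtain ⟨t, ht, hts, htf, -⟩ := hf s hs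
    obtain rfl | ⟨x, hx, rfl⟩ := ht
    · exact absurd hts WithOne.one_ne_coe
    · exact ⟨x, hx, WithOne.coe_injective hts, htf⟩
  -- Nonemptiness matters: the idempotence of `f` is only available through an element of `P`, and
  -- so is a term showing that `f` is not the adjoined identity.
  obtain ⟨s₀, hs₀⟩ : P.Nonempty := by
    rw [← hP, Set.image_nonempty, ← Set.image_nonempty (f := proj DA A), he]
    exact Set.singleton_nonempty e
  obtain ⟨x₀, hx₀, hx₀s, rfl⟩ := hterm s₀ hs₀
  refine ⟨{x | IsTerm omegaSignature A x ∧ φ x ∈ P ∧ proj DA A x = proj DA A x₀},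
    proj DA A x₀, fun x hx => hx.1, ?_, ?_, fun hi => ?_⟩
  · apply subset_antisymm
    · rintro _ ⟨x, hx, rfl⟩
      exact hx.2.1
    · intro s hs
      obtain ⟨x, hx, rfl, hxf⟩ := hterm s hs
      exact ⟨x, ⟨hx, hs, WithOne.coe_injective hxf⟩, rfl⟩
  · apply subset_antisymm
    · rintro _ ⟨x, hx, rfl⟩
      exact hx.2.2
    · rintro _ rfl
      exact ⟨x₀, ⟨hx₀, hx₀s.symm ▸ hs₀, rfl⟩, rfl⟩
  · exact WithOne.coe_injective (hfi hi s₀ hs₀)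

end Reducibility

end PV

theorem corollaryc :
    PV.PointlikeReducible.{u, v} PV.omegaSignature PV.DA.{v} ∧
      PV.IdempotentPointlikeReducible.{u, v} PV.omegaSignature PV.DA.{v} := by
  constructor
  · intro S _ _ P hP A _ φ hφ
    obtain ⟨P', h, e, he⟩ := hP A φ hφ
    obtain ⟨Q, f, hQ, hφQ, hf, -⟩ := PV.exists_terms_of_witness hφ.1 h he
    exact ⟨Q, hQ, hφQ, f, hf⟩
  · intro S _ _ P hP A _ φ hφ
    obtain ⟨P', h, e, hi, he⟩ := hP A φ hφ
    obtain ⟨Q, f, hQ, hφQ, hf, hfi⟩ := PV.exists_terms_of_witness hφ.1 h he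
    exact ⟨Q, hQ, hφQ, f, hfi hi, hf⟩
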